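/- All rational functions have complex coefficients; a rational function $F$ of degree $n\ge 1$ is regarded as a map $\mathbb{CP}^1\to\mathbb{CP}^1$. A point $w\in\mathbb{CP}^1$ is a non-critical value of $F$ if it has exactly $n$ preimages. For such $w$, the monodromy group of $F$ is the group of those permutations of $F^{-1}(w)$ that are induced by lifting along $F$ loops based at $w$ in the complement of the set of critical values; up to permutation equivalence it does not depend on $w$. Two permutation groups $G\le\mathrm{Sym}(\Omega)$ and $G'\le\mathrm{Sym}(\Omega')$ are permutation equivalent if some bijection $\Omega\to\Omega'$ carries $G$ to $G'$. A group is called Hamiltonian if all its subgroups are normal (in particular, cyclic and abelian groups are Hamiltonian). A rational function $A$ is indecomposable if $A=A_1\circ A_2$ with rational functions $A_1,A_2$ implies $\deg A_1=1$ or $\deg A_2=1$. A decomposition $F=F_1\circ\dots\circ F_r$ is maximal if every $F_i$ is indecomposable and of degree greater than one. Two decompositions $F=U_1\circ\dots\circ U_k$ and $F=V_1\circ\dots\circ V_m$ are equivalent if $k=m$ and there are rational functions $\mu_1,\dots,\mu_{k-1}$ of degree one such that, with $\mu_0=\mu_k=z$, $U_i=\mu_{i-1}^{-1}\circ V_i\circ\mu_i$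 for $1\le i\le k$. Two maximal decompositions $\mathcal D,\mathcal E$ of $F$ are weakly equivalent if there is a chain $\mathcal F_1,\dots,\mathcal F_s$ of maximal decompositions of $F$ such that $\mathcal F_1=\mathcal D$, $\mathcal F_s$ is equivalent to $\mathcal E$, and each $\mathcal F_{j+1}$ is obtained from $\mathcal F_j$ by replacing two successive functions by two other functions with the same composition. **Corollary 2.11.** Let $F$ be a rational function whose monodromy group contains a transitive Hamiltonian subgroup. Then any two maximal decompositions of $F$ are weakly equivalent. Furthermore, any two maximal decompositions $$F=U_1\circ U_2\circ\dots\circ U_k\quad\text{and}\quad F=V_1\circ V_2\circ\dots\circ V_m$$ have the same length, $k=m$, and there exists a permutation $\sigma\in S_k$ such that the monodromy groups of $U_i$ and $V_{\sigma(i)}$ are permutation equivalent for $1\le i\le k$. -/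

import Mathlib

open scoped OnePoint

noncomputable section

namespace RatDecomp

/-- The degree of a complex rational function, written in lowest terms. -/
def degree (F : RatFunc ℂ) : ℕ := max F.num.natDegree F.denom.natDegree

/-- The superposition `A ∘ B`, that is `A(B(z))`, as a rational function. -/
def comp (A B : RatFunc ℂ) : RatFunc ℂ := RatFunc.eval RatFunc.C B A

/-- The self-map of the Riemann sphere `OnePoint ℂ` defined by a rational function. A finite point
is sent to `∞` exactly if it is a pole; the value at `∞` is the limit of `F z` as `z → ∞`. -/
def sphereMap (F : RatFunc ℂ) (p : OnePoint ℂ) : OnePoint ℂ :=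
  p.elim
    (if F.denom.natDegree < F.num.natDegree then ∞
      else ((F.num.coeff F.denom.natDegree / F.denom.leadingCoeff : ℂ) : OnePoint ℂ))
    (fun z : ℂ => if F.denom.eval z = 0 then ∞
      else ((F.num.eval z / F.denom.eval z : ℂ) : OnePoint ℂ))

/-- The preimage of a point of the sphere. -/
def fiber (F : RatFunc ℂ) (w : OnePoint ℂ) : Set (OnePoint ℂ) := {z | sphereMap F z = w}

/-- `w` is not a critical value of `F`: it has `deg F` distinct preimages on the sphere. -/
def IsNoncriticalValue (F : RatFunc ℂ) (w : OnePoint ℂ) : Prop :=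
  (fiber F w).encard = degree F

/-- The permutation `σ` of the fiber over `w` is induced by lifting a loop based at `w`
which avoids the critical values of `F`. -/
def IsMonodromyPerm (F : RatFunc ℂ) (w : OnePoint ℂ) (σ : Equiv.Perm (fiber F w)) : Prop :=
  ∃ γ : Path w w, (∀ t, IsNoncriticalValue F (γ t)) ∧
    ∀ x : fiber F w, ∃ Γ : Path (x : OnePoint ℂ) (σ x : OnePoint ℂ),
      ∀ t, sphereMap F (Γ t) = γ t

theorem IsMonodromyPerm.mul {F : RatFunc ℂ} {w : OnePoint ℂ} {σ τ : Equiv.Perm (fiber F w)}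
    (hσ : IsMonodromyPerm F w σ) (hτ : IsMonodromyPerm F w τ) :
    IsMonodromyPerm F w (σ * τ) := by
  obtain ⟨γ, hγ, hl⟩ := hσ
  obtain ⟨δ, hδ, hm⟩ := hτ
  refine ⟨δ.trans γ, fun t => ?_, fun x => ?_⟩
  · rw [Path.trans_apply]
    split_ifs
    · exact hδ _
    · exact hγ _
  · obtain ⟨Δ, hΔ⟩ := hm x
    obtain ⟨Γ, hΓ⟩ := hl (τ x)
    rw [Equiv.Perm.mul_apply]
    refine ⟨Δ.trans Γ, fun t => ?_⟩
    rw [Path.trans_apply, Path.trans_apply]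
    split_ifs
    · exact hΔ _
    · exact hΓ _

theorem IsMonodromyPerm.inv {F : RatFunc ℂ} {w : OnePoint ℂ} {σ : Equiv.Perm (fiber F w)}
    (hσ : IsMonodromyPerm F w σ) : IsMonodromyPerm F w σ⁻¹ := by
  obtain ⟨γ, hγ, hl⟩ := hσ
  refine ⟨γ.symm, fun t => hγ _, fun x => ?_⟩
  obtain ⟨Γ, hΓ⟩ := hl (σ⁻¹ x)
  refine ⟨Γ.symm.cast (by simp) rfl, fun t => ?_⟩
  simpa using hΓ (unitInterval.symm t)

/-- The monodromy group of `F`, realized as a permutation group on the preimages of a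
non-critical value `w`. -/
def monodromyGroup (F : RatFunc ℂ) (w : OnePoint ℂ) (hw : IsNoncriticalValue F w) :
    Subgroup (Equiv.Perm (fiber F w)) where
  carrier := {σ | IsMonodromyPerm F w σ}
  one_mem' := ⟨Path.refl w, fun _ => hw, fun x => ⟨Path.refl _, fun _ => x.2⟩⟩
  mul_mem' := IsMonodromyPerm.mul
  inv_mem' := IsMonodromyPerm.inv

/-- A group all of whose subgroups are normal (abelian groups are included). -/
def IsHamiltonian (K : Type*) [Group K] : Prop := ∀ H : Subgroup K, H.Normal

/-- Two permutation groups are permutation equivalent if some bijection of the underlying sets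
carries one to the other. -/
def PermEquivalent {Ω Ω' : Type*} (G : Subgroup (Equiv.Perm Ω)) (G' : Subgroup (Equiv.Perm Ω')) :
    Prop :=
  ∃ e : Ω ≃ Ω', G.map (e.permCongrHom : Equiv.Perm Ω →* Equiv.Perm Ω') = G'

/-- The monodromy groups of `A` and `B` are permutation equivalent, whichever non-critical values
are used to realize them. -/
def SameMonodromy (A B : RatFunc ℂ) : Prop :=
  ∀ (a b : OnePoint ℂ) (ha : IsNoncriticalValue A a) (hb : IsNoncriticalValue B b),
    PermEquivalent (monodromyGroup A a ha) (monodromyGroup B b hb)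

/-- If `F = A ∘ B`, then `A` or `B` has degree one. -/
def IsIndecomposable (F : RatFunc ℂ) : Prop :=
  ∀ A B : RatFunc ℂ, F = comp A B → degree A = 1 ∨ degree B = 1

/-- The list `[F₁, …, F_r]` is a decomposition `F = F₁ ∘ ⋯ ∘ F_r`. -/
def IsDecomposition (F : RatFunc ℂ) (L : List (RatFunc ℂ)) : Prop :=
  F = L.foldr comp RatFunc.X

/-- A decomposition into indecomposable functions of degree greater than one. -/
def IsMaximalDecomposition (F : RatFunc ℂ) (L : List (RatFunc ℂ)) : Prop :=
  IsDecomposition F L ∧ ∀ A ∈ L, IsIndecomposable A ∧ 1 < degree A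

/-- Equivalence of decompositions: `U₁ = V₁ ∘ μ₁`, `Uᵢ = μᵢ₋₁⁻¹ ∘ Vᵢ ∘ μᵢ`, `U_k = μ_{k-1}⁻¹ ∘ V_k`
with all `μᵢ` of degree one. The two outer `μ`s are the identity. -/
def DecompEquiv (U V : List (RatFunc ℂ)) : Prop :=
  ∃ h : U.length = V.length, ∃ μ : ℕ → RatFunc ℂ,
    (∀ i, degree (μ i) = 1) ∧ μ 0 = RatFunc.X ∧ μ U.length = RatFunc.X ∧
    ∀ (i : ℕ) (hi : i < U.length),
      comp (μ i) U[i] = comp (V[i]'(h ▸ hi)) (μ (i + 1))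

/-- `L'` is obtained from `L` by replacing two successive functions by two functions
with the same composition. -/
def RittMove (L L' : List (RatFunc ℂ)) : Prop :=
  ∃ (l r : List (RatFunc ℂ)) (A B C D : RatFunc ℂ), comp A B = comp C D ∧
    L = l ++ A :: B :: r ∧ L' = l ++ C :: D :: r

/-- Weak equivalence of maximal decompositions of `F`: a chain of such moves through maximal
decompositions of `F` leads from `U` to a maximal decomposition equivalent to `V`. -/
def WeaklyEquivalent (F : RatFunc ℂ) (U V : List (RatFunc ℂ)) : Prop :=
  ∃ W : List (RatFunc ℂ),
    Relation.ReflTransGen (fun L L' => IsMaximalDecomposition F L ∧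
      IsMaximalDecomposition F L' ∧ RittMove L L') U W ∧ DecompEquiv W V

end RatDecomp

end

/-! By Lüroth's theorem, decompositions of `F` up to degree-one factors are chains of fields between
ℂ(F) and ℂ(z); over a general value they are chains of monodromy-invariant partitions of the fibre.
The theorem is a Jordan–Hölder theorem for these chains.

The group enters through one fact: in a Hamiltonian group acting transitively, the stabiliser of a
block is normal, so an element preserving one block of an invariant partition preserves them all
(`forall_eq_of_isHamiltonian`). Hence two points of one block are joined by a monodromy permutation
preserving every block (`HasHamiltonianAction.exists_move`), and the partitions of two right factors
permute (`HasHamiltonianAction.exists_permute`).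

Let F = A' ∘ A = C' ∘ C with A', C' indecomposable and A not in ℂ(C). After a common right factor is
cancelled, ℂ(A, C) = ℂ(z), and indecomposability gives ℂ(A) ∩ ℂ(C) = ℂ(F). As the partitions
permute, the coefficients of the minimal polynomial of A over ℂ(C) are constant on fibres of A, so
they lie in ℂ(F). Counting roots, A maps a general fibre of C bijectively onto a fibre of A'
(`exists_bijOn`). Therefore C and A' have the same degree and monodromy group, likewise A and C'
(`bijOn_consequences`), and A and C are again indecomposable (`isIndecomposable_of_pair`). This
diamond is a single move that interchanges monodromy groups, and `jordanHolder` follows by induction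
on the degree.

The topological input is that F is a covering off finitely many values (`isCoveringMapOn_sphereMap`)
and that a path can be pushed off a finite set without changing its transport
(`exists_transport_avoiding`). The latter is needed because a composition can have more critical
values than its factors. -/

noncomputable section

namespace RatDecomp

open Filter Topology Polynomial

/-! ### The Riemann sphere in homogeneous coordinates -/

/-- The point of the Riemann sphere with homogeneous coordinates `[a : b]`. -/
def proj (a b : ℂ) : OnePoint ℂ := if b = 0 then ∞ else ((a / b : ℂ) : OnePoint ℂ)

theorem proj_zero (a : ℂ) : proj a 0 = ∞ := by simp [proj]

theorem proj_of_ne {a b : ℂ} (hb : b ≠ 0) : proj a b = ((a / b : ℂ) : OnePoint ℂ) := by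
  simp [proj, hb]

theorem proj_one (a : ℂ) : proj a 1 = (a : OnePoint ℂ) := by simp [proj]

theorem proj_mul {c : ℂ} (hc : c ≠ 0) (a b : ℂ) : proj (c * a) (c * b) = proj a b := by
  by_cases hb : b = 0
  · simp [proj, hb]
  · simp [proj, hb, hc, mul_div_mul_left]

theorem proj_eq_infty_iff {a b : ℂ} : proj a b = ∞ ↔ b = 0 := by
  by_cases hb : b = 0 <;> simp [proj, hb]

theorem proj_eq_coe_iff {a b w : ℂ} (h : a ≠ 0 ∨ b ≠ 0) :
    proj a b = (w : OnePoint ℂ) ↔ a - w * b = 0 := by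
  by_cases hb : b = 0
  · have ha : a ≠ 0 := by simpa [hb] using h
    simp [proj, hb, ha]
  · rw [proj_of_ne hb, OnePoint.coe_eq_coe, div_eq_iff hb, sub_eq_zero]

/-- At a point [a : 0], a compact set lies in some disc of radius R, and the quotient leaves that
disc on the open set where R‖b‖ < ‖a‖. Only (0, 0) must be excluded. -/
theorem continuousAt_proj {p : ℂ × ℂ} (h : p.1 ≠ 0 ∨ p.2 ≠ 0) :
    ContinuousAt (fun p : ℂ × ℂ => proj p.1 p.2) p := by
  by_cases hb : p.2 = 0
  · have ha : p.1 ≠ 0 := by simpa [hb] using h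
    rw [ContinuousAt, hb, proj_zero, OnePoint.hasBasis_nhds_infty.tendsto_right_iff]
    rintro s ⟨-, hs⟩
    obtain ⟨R, hR⟩ := hs.isBounded.exists_norm_le
    have : ∀ᶠ q : ℂ × ℂ in 𝓝 p, R * ‖q.2‖ < ‖q.1‖ := by
      apply ContinuousAt.eventually_lt (by fun_prop) (by fun_prop)
      simpa [hb] using ha
    filter_upwards [this] with q hq
    by_cases hq2 : q.2 = 0
    · simp [proj, hq2]
    · left
      refine ⟨q.1 / q.2, fun hm => ?_, by simp [proj, hq2]⟩
      have h1 := hR _ hm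
      rw [norm_div, div_le_iff₀ (norm_pos_iff.2 hq2)] at h1
      linarith
  · have h1 : ∀ᶠ q : ℂ × ℂ in 𝓝 p, q.2 ≠ 0 := continuous_snd.continuousAt.eventually_ne hb
    have h2 : ContinuousAt (fun q : ℂ × ℂ => ((q.1 / q.2 : ℂ) : OnePoint ℂ)) p :=
      (OnePoint.continuous_coe.continuousAt).comp
        (continuousAt_fst.div continuousAt_snd hb)
    refine h2.congr ?_
    filter_upwards [h1] with q hq
    rw [proj_of_ne hq]

/-- The inversion `z ↦ 1 / z` of the Riemann sphere. -/
def inversion (p : OnePoint ℂ) : OnePoint ℂ := p.elim ((0 : ℂ) : OnePoint ℂ) (fun z => proj 1 z)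

@[simp] theorem inversion_infty : inversion ∞ = ((0 : ℂ) : OnePoint ℂ) := rfl

@[simp] theorem inversion_coe (z : ℂ) : inversion (z : OnePoint ℂ) = proj 1 z := rfl

theorem inversion_proj {a b : ℂ} (h : a ≠ 0 ∨ b ≠ 0) : inversion (proj a b) = proj b a := by
  by_cases hb : b = 0
  · have ha : a ≠ 0 := by simpa [hb] using h
    simp [hb, proj_zero, proj_of_ne ha]
  · rw [proj_of_ne hb, inversion_coe, ← proj_mul hb, mul_one, mul_div_cancel₀ _ hb]

theorem inversion_inversion (p : OnePoint ℂ) : inversion (inversion p) = p := by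
  induction p using OnePoint.rec with
  | infty => simp [proj_zero]
  | coe z => rw [inversion_coe, inversion_proj (by simp), proj_one]

theorem continuous_proj_one : Continuous (fun s : ℂ => proj 1 s) := by
  refine continuous_iff_continuousAt.2 fun s => ?_
  exact (continuousAt_proj (p := ((1 : ℂ), s)) (by simp)).comp
    (f := fun s : ℂ => ((1 : ℂ), s)) (by fun_prop)

theorem continuous_inversion : Continuous inversion := by
  rw [continuous_iff_continuousAt]
  intro p
  induction p using OnePoint.rec with
  | infty =>
    rw [OnePoint.continuousAt_infty', inversion_infty]
    have h1 : Tendsto (fun z : ℂ => ((z⁻¹ : ℂ) : OnePoint ℂ)) (coclosedCompact ℂ)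
        (𝓝 ((0 : ℂ) : OnePoint ℂ)) := by
      rw [coclosedCompact_eq_cocompact, ← Metric.cobounded_eq_cocompact]
      exact (OnePoint.continuous_coe.tendsto _).comp tendsto_inv₀_cobounded
    refine h1.congr' ?_
    rw [coclosedCompact_eq_cocompact]
    have : ({0}ᶜ : Set ℂ) ∈ cocompact ℂ := isCompact_singleton.compl_mem_cocompact
    filter_upwards [this] with z hz
    simp [proj_of_ne (show z ≠ 0 from hz)]
  | coe z =>
    rw [OnePoint.continuousAt_coe]
    exact continuous_proj_one.continuousAt

/-- Inversion as a homeomorphism of the Riemann sphere. -/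
def inversionHomeo : OnePoint ℂ ≃ₜ OnePoint ℂ where
  toFun := inversion
  invFun := inversion
  left_inv := inversion_inversion
  right_inv := inversion_inversion
  continuous_toFun := continuous_inversion
  continuous_invFun := continuous_inversion

theorem coe_inversionHomeo : ⇑inversionHomeo = inversion := rfl

/-- The coordinate s = 1/z at infinity: local statements at `∞` become statements about polynomials
in s near 0. -/
theorem nhds_infty_eq_map : 𝓝 (∞ : OnePoint ℂ) = map (fun s : ℂ => proj 1 s) (𝓝 0) := by
  have h := inversionHomeo.map_nhds_eq ((0 : ℂ) : OnePoint ℂ)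
  have h0 : inversionHomeo ((0 : ℂ) : OnePoint ℂ) = ∞ := by
    rw [coe_inversionHomeo, inversion_coe, proj_zero]
  rw [h0, OnePoint.nhds_coe_eq, Filter.map_map, coe_inversionHomeo] at h
  exact h.symm

/-! ### The sphere map in the two affine charts -/

theorem num_denom_ne_zero (F : RatFunc ℂ) (z : ℂ) : F.num.eval z ≠ 0 ∨ F.denom.eval z ≠ 0 := by
  by_contra! h
  obtain ⟨a, b, hab⟩ := F.isCoprime_num_denom
  have := congrArg (Polynomial.eval z) hab
  simp [h.1, h.2] at this

theorem sphereMap_coe (F : RatFunc ℂ) (z : ℂ) :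
    sphereMap F (z : OnePoint ℂ) = proj (F.num.eval z) (F.denom.eval z) := rfl

theorem sphereMap_infty (F : RatFunc ℂ) :
    sphereMap F ∞ = proj (F.num.coeff (degree F)) (F.denom.coeff (degree F)) := by
  unfold sphereMap degree
  simp only [OnePoint.elim_infty]
  split_ifs with h
  · rw [max_eq_left h.le, coeff_eq_zero_of_natDegree_lt h, proj_zero]
  · rw [max_eq_right (not_lt.1 h), coeff_natDegree, proj_of_ne]
    exact leadingCoeff_ne_zero.2 F.denom_ne_zero

theorem coeff_degree_ne_zero (F : RatFunc ℂ) :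
    F.num.coeff (degree F) ≠ 0 ∨ F.denom.coeff (degree F) ≠ 0 := by
  unfold degree
  rcases le_total F.num.natDegree F.denom.natDegree with h | h
  · right
    rw [max_eq_right h, coeff_natDegree]
    exact leadingCoeff_ne_zero.2 F.denom_ne_zero
  · rw [max_eq_left h]
    by_cases h0 : F.num = 0
    · have : F = 0 := RatFunc.num_eq_zero_iff.1 h0
      subst this
      simp
    · left
      rw [coeff_natDegree]
      exact leadingCoeff_ne_zero.2 h0

theorem eval_reflect_inv {P : ℂ[X]} {n : ℕ} (hP : P.natDegree ≤ n) {s : ℂ} (hs : s ≠ 0) :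
    (P.reflect n).eval s = s ^ n * P.eval s⁻¹ := by
  let : Invertible s⁻¹ := invertibleOfNonzero (inv_ne_zero hs)
  have := eval₂_reflect_mul_pow (RingHom.id ℂ) s⁻¹ n P hP
  simp only [invOf_eq_inv, inv_inv, eval₂_id] at this
  rw [← this, mul_comm, mul_assoc, ← mul_pow, inv_mul_cancel₀ hs, one_pow, mul_one]

theorem eval_reflect_zero (P : ℂ[X]) (n : ℕ) : (P.reflect n).eval 0 = P.coeff n := by
  rw [← coeff_zero_eq_eval_zero, coeff_reflect, revAt_le (Nat.zero_le n), Nat.sub_zero]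

theorem natDegree_num_le (F : RatFunc ℂ) : F.num.natDegree ≤ degree F := le_max_left _ _

theorem natDegree_denom_le (F : RatFunc ℂ) : F.denom.natDegree ≤ degree F := le_max_right _ _

/-- In the coordinate s = 1/z, numerator and denominator become their reversed polynomials; the
common factor s ^ n cancels in homogeneous coordinates. -/
theorem sphereMap_proj_one (F : RatFunc ℂ) (s : ℂ) :
    sphereMap F (proj 1 s) =
      proj ((F.num.reflect (degree F)).eval s) ((F.denom.reflect (degree F)).eval s) := by
  by_cases hs : s = 0
  · subst hs
    rw [proj_zero, sphereMap_infty, eval_reflect_zero, eval_reflect_zero]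
  · rw [proj_of_ne hs, sphereMap_coe, eval_reflect_inv (natDegree_num_le F) hs,
      eval_reflect_inv (natDegree_denom_le F) hs, proj_mul (pow_ne_zero _ hs), one_div]

theorem reflect_ne_zero (F : RatFunc ℂ) (s : ℂ) :
    (F.num.reflect (degree F)).eval s ≠ 0 ∨ (F.denom.reflect (degree F)).eval s ≠ 0 := by
  by_cases hs : s = 0
  · subst hs
    rw [eval_reflect_zero, eval_reflect_zero]
    exact coeff_degree_ne_zero F
  · rw [eval_reflect_inv (natDegree_num_le F) hs, eval_reflect_inv (natDegree_denom_le F) hs]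
    simpa [hs] using num_denom_ne_zero F s⁻¹

theorem continuousAt_proj_eval {f g : ℂ[X]} {z : ℂ} (h : f.eval z ≠ 0 ∨ g.eval z ≠ 0) :
    ContinuousAt (fun z => proj (f.eval z) (g.eval z)) z :=
  (continuousAt_proj (p := (f.eval z, g.eval z)) h).comp
    (f := fun z : ℂ => (f.eval z, g.eval z)) (by fun_prop)

theorem continuous_sphereMap (F : RatFunc ℂ) : Continuous (sphereMap F) := by
  rw [continuous_iff_continuousAt]
  intro p
  induction p using OnePoint.rec with
  | infty =>
    have h := continuousAt_proj_eval (reflect_ne_zero F 0)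
    rw [ContinuousAt, nhds_infty_eq_map, tendsto_map'_iff]
    have h2 : sphereMap F ∞ = sphereMap F (proj 1 0) := by rw [proj_zero]
    rw [h2]
    simpa only [ContinuousAt, Function.comp_def, sphereMap_proj_one] using h
  | coe z =>
    rw [OnePoint.continuousAt_coe]
    exact continuousAt_proj_eval (num_denom_ne_zero F z)

theorem polynomial_eq_zero_of_eventually {f : ℂ[X]} {z : ℂ} (h : ∀ᶠ x in 𝓝 z, f.eval x = 0) :
    f = 0 := by
  refine Polynomial.eq_zero_of_infinite_isRoot f ?_
  exact infinite_of_mem_nhds z h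

/-- The open mapping theorem for f / g; local constancy would make f a scalar multiple of g by the
identity theorem for polynomials. -/
theorem nhds_le_map_proj_of_ne {f g : ℂ[X]} (hfg : ∀ c : ℂ, f ≠ C c * g) {z : ℂ}
    (hz : g.eval z ≠ 0) :
    𝓝 (proj (f.eval z) (g.eval z)) ≤ map (fun z => proj (f.eval z) (g.eval z)) (𝓝 z) := by
  have hne : ∀ᶠ x in 𝓝 z, g.eval x ≠ 0 := (by fun_prop : ContinuousAt _ z).eventually_ne hz
  have ha : AnalyticAt ℂ (fun x => f.eval x / g.eval x) z :=
    (AnalyticAt.aeval_polynomial (analyticAt_id) f).div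
      (AnalyticAt.aeval_polynomial (analyticAt_id) g) hz
  have hev : (fun x => proj (f.eval x) (g.eval x)) =ᶠ[𝓝 z]
      (fun x => (((f.eval x / g.eval x : ℂ)) : OnePoint ℂ)) := by
    filter_upwards [hne] with x hx using proj_of_ne hx
  rcases ha.eventually_constant_or_nhds_le_map_nhds with h | h
  · exfalso
    apply hfg (f.eval z / g.eval z)
    rw [← sub_eq_zero]
    apply polynomial_eq_zero_of_eventually (z := z)
    filter_upwards [h, hne] with x hx hx2
    rw [eval_sub, eval_mul, eval_C, ← hx, div_mul_cancel₀ _ hx2, sub_self]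
  · rw [Filter.map_congr hev, proj_of_ne hz, OnePoint.nhds_coe_eq]
    exact Filter.map_mono h

theorem nhds_le_map_proj {f g : ℂ[X]} (hfg : ∀ c : ℂ, f ≠ C c * g) (hgf : ∀ c : ℂ, g ≠ C c * f)
    {z : ℂ} (hz : f.eval z ≠ 0 ∨ g.eval z ≠ 0) :
    𝓝 (proj (f.eval z) (g.eval z)) ≤ map (fun z => proj (f.eval z) (g.eval z)) (𝓝 z) := by
  by_cases hg : g.eval z = 0
  · have hf : f.eval z ≠ 0 := by simpa [hg] using hz
    have hne : ∀ᶠ x in 𝓝 z, f.eval x ≠ 0 := (by fun_prop : ContinuousAt _ z).eventually_ne hf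
    -- At a pole the roles of f and g are exchanged by the inversion.
    have h := Filter.map_mono (m := inversion) (nhds_le_map_proj_of_ne hgf hf)
    have h1 := inversionHomeo.map_nhds_eq (proj (g.eval z) (f.eval z))
    rw [coe_inversionHomeo] at h1
    rw [h1, inversion_proj (Or.inr hf), Filter.map_map] at h
    refine h.trans (le_of_eq (Filter.map_congr ?_))
    filter_upwards [hne] with x hx
    exact inversion_proj (Or.inr hx)
  · exact nhds_le_map_proj_of_ne hfg hg

theorem num_ne_C_mul_denom {F : RatFunc ℂ} (hF : degree F ≠ 0) (c : ℂ) :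
    F.num ≠ C c * F.denom := by
  intro h
  have hd : IsUnit F.denom := by
    apply F.isCoprime_num_denom.symm.isUnit_of_dvd
    exact Dvd.intro_left _ h.symm
  have h1 : F.denom.natDegree = 0 := natDegree_eq_zero_of_isUnit hd
  have h2 : F.num.natDegree = 0 := by
    rw [h]
    exact Nat.le_zero.1 ((natDegree_C_mul_le _ _).trans h1.le)
  exact hF (by simp [degree, h1, h2])

theorem denom_ne_C_mul_num {F : RatFunc ℂ} (hF : degree F ≠ 0) (c : ℂ) :
    F.denom ≠ C c * F.num := by
  intro h
  have hd : IsUnit F.num := by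
    apply F.isCoprime_num_denom.isUnit_of_dvd
    exact Dvd.intro_left _ h.symm
  have h1 : F.num.natDegree = 0 := natDegree_eq_zero_of_isUnit hd
  have h2 : F.denom.natDegree = 0 := by
    rw [h]
    exact Nat.le_zero.1 ((natDegree_C_mul_le _ _).trans h1.le)
  exact hF (by simp [degree, h1, h2])

theorem eq_C_mul_of_reflect {f g : ℂ[X]} {n : ℕ} {c : ℂ} (h : f.reflect n = C c * g.reflect n) :
    f = C c * g := by
  rw [← reflect_C_mul] at h
  ext i
  have := congrArg (fun p => coeff p (revAt n i)) h
  simpa [coeff_reflect] using this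

theorem isOpenMap_sphereMap {F : RatFunc ℂ} (hF : degree F ≠ 0) : IsOpenMap (sphereMap F) := by
  rw [isOpenMap_iff_nhds_le]
  intro p
  induction p using OnePoint.rec with
  | infty =>
    have h := nhds_le_map_proj (fun c hc => num_ne_C_mul_denom hF c (eq_C_mul_of_reflect hc))
      (fun c hc => denom_ne_C_mul_num hF c (eq_C_mul_of_reflect hc)) (reflect_ne_zero F 0)
    rw [nhds_infty_eq_map, Filter.map_map]
    have h2 : sphereMap F ∞ = sphereMap F (proj 1 0) := by rw [proj_zero]
    rw [h2]
    simpa only [Function.comp_def, sphereMap_proj_one] using h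
  | coe z =>
    rw [OnePoint.nhds_coe_eq, Filter.map_map]
    exact nhds_le_map_proj (num_ne_C_mul_denom hF) (denom_ne_C_mul_num hF) (num_denom_ne_zero F z)

/-- The image is open, and compact hence closed, in the connected sphere. -/
theorem surjective_sphereMap {F : RatFunc ℂ} (hF : degree F ≠ 0) :
    Function.Surjective (sphereMap F) := by
  rw [← Set.range_eq_univ]
  refine IsClopen.eq_univ ⟨?_, (isOpenMap_sphereMap hF).isOpen_range⟩ (Set.range_nonempty _)
  exact (isCompact_range (continuous_sphereMap F)).isClosed

end RatDecomp

end

noncomputable section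

namespace RatDecomp

open Filter Topology Polynomial

/-! ### Counting preimages -/

/-- The point `∞` counts as a root when the degree of R drops below n; the drop leaves room for it
in the bound. -/
theorem encard_le_of_polynomial {R : ℂ[X]} {n : ℕ} {T : Set (OnePoint ℂ)} (hR : R ≠ 0)
    (hn : R.natDegree ≤ n) (hcoe : ∀ z : ℂ, (z : OnePoint ℂ) ∈ T → R.eval z = 0)
    (hinf : ∞ ∈ T → R.coeff n = 0) : T.encard ≤ n := by
  have hfin : ((↑) '' (R.roots.toFinset : Set ℂ) : Set (OnePoint ℂ)).encard ≤ R.natDegree := by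
    rw [OnePoint.coe_injective.encard_image, Set.encard_coe_eq_coe_finsetCard, Nat.cast_le]
    exact (Multiset.toFinset_card_le _).trans (card_roots' R)
  have hmem : ∀ z : ℂ, (z : OnePoint ℂ) ∈ T → (z : OnePoint ℂ) ∈
      ((↑) '' (R.roots.toFinset : Set ℂ) : Set (OnePoint ℂ)) := fun z hz =>
    ⟨z, by simpa [hR] using hcoe z hz, rfl⟩
  by_cases h : ∞ ∈ T
  · have hlt : R.natDegree < n := by
      refine lt_of_le_of_ne hn fun he => hR ?_
      rw [← leadingCoeff_eq_zero, leadingCoeff, he]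
      exact hinf h
    have hsub : T ⊆ insert ∞ ((↑) '' (R.roots.toFinset : Set ℂ)) := by
      intro p hp
      induction p using OnePoint.rec with
      | infty => exact Set.mem_insert _ _
      | coe z => exact Set.mem_insert_of_mem _ (hmem z hp)
    calc T.encard ≤ _ := Set.encard_le_encard hsub
      _ ≤ _ := Set.encard_insert_le _ _
      _ ≤ (R.natDegree : ℕ∞) + 1 := by gcongr
      _ ≤ n := by exact_mod_cast hlt
  · have hsub : T ⊆ ((↑) '' (R.roots.toFinset : Set ℂ)) := by
      intro p hp
      induction p using OnePoint.rec with
      | infty => exact absurd hp h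
      | coe z => exact hmem z hp
    exact (Set.encard_le_encard hsub).trans (hfin.trans (by exact_mod_cast hn))

theorem mem_fiber {F : RatFunc ℂ} {w z : OnePoint ℂ} : z ∈ fiber F w ↔ sphereMap F z = w := Iff.rfl

theorem coe_mem_fiber_coe {F : RatFunc ℂ} {w z : ℂ} :
    (z : OnePoint ℂ) ∈ fiber F w ↔ (F.num - C w * F.denom).eval z = 0 := by
  rw [mem_fiber, sphereMap_coe, proj_eq_coe_iff (num_denom_ne_zero F z)]
  simp

theorem infty_mem_fiber_coe {F : RatFunc ℂ} {w : ℂ} :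
    ∞ ∈ fiber F w ↔ (F.num - C w * F.denom).coeff (degree F) = 0 := by
  rw [mem_fiber, sphereMap_infty, proj_eq_coe_iff (coeff_degree_ne_zero F)]
  simp

theorem num_sub_ne_zero {F : RatFunc ℂ} (hF : degree F ≠ 0) (w : ℂ) :
    F.num - C w * F.denom ≠ 0 := fun h => num_ne_C_mul_denom hF w (sub_eq_zero.1 h)

theorem natDegree_num_sub_le (F : RatFunc ℂ) (w : ℂ) :
    (F.num - C w * F.denom).natDegree ≤ degree F :=
  (natDegree_sub_le _ _).trans
    (max_le (natDegree_num_le F) ((natDegree_C_mul_le _ _).trans (natDegree_denom_le F)))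

theorem encard_fiber_le {F : RatFunc ℂ} (hF : degree F ≠ 0) (w : OnePoint ℂ) :
    (fiber F w).encard ≤ degree F := by
  induction w using OnePoint.rec with
  | infty =>
    refine encard_le_of_polynomial F.denom_ne_zero (natDegree_denom_le F) (fun z hz => ?_)
      fun h => ?_
    · rwa [mem_fiber, sphereMap_coe, proj_eq_infty_iff] at hz
    · rwa [mem_fiber, sphereMap_infty, proj_eq_infty_iff] at h
  | coe w =>
    exact encard_le_of_polynomial (num_sub_ne_zero hF w) (natDegree_num_sub_le F w)
      (fun z hz => coe_mem_fiber_coe.1 hz) (fun h => infty_mem_fiber_coe.1 h)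

theorem finite_fiber {F : RatFunc ℂ} (hF : degree F ≠ 0) (w : OnePoint ℂ) : (fiber F w).Finite :=
  Set.finite_of_encard_le_coe (encard_fiber_le hF w)

/-- A double root of num − w · denom is a zero of the Wronskian, so here all roots are simple; as
`∞` is not in the fibre, there are exactly deg F of them. -/
theorem isNoncriticalValue_of_forall {F : RatFunc ℂ} (hF : degree F ≠ 0) {w : ℂ}
    (hinf : sphereMap F ∞ ≠ w)
    (hw : ∀ z : ℂ, (wronskian F.num F.denom).eval z = 0 → sphereMap F z ≠ w) :
    IsNoncriticalValue F w := by
  set R := F.num - C w * F.denom with hR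
  have hR0 : R ≠ 0 := num_sub_ne_zero hF w
  have hdeg : R.natDegree = degree F := by
    refine le_antisymm (natDegree_num_sub_le F w) (le_natDegree_of_ne_zero fun h => hinf ?_)
    exact infty_mem_fiber_coe.2 h
  have hnodup : R.roots.Nodup := by
    classical
    rw [Multiset.nodup_iff_count_le_one]
    intro z
    rw [count_roots]
    by_contra! h
    obtain ⟨h1, h2⟩ := (one_lt_rootMultiplicity_iff_isRoot hR0).1 h
    refine hw z ?_ (coe_mem_fiber_coe.2 h1)
    simp only [hR, IsRoot, eval_sub, eval_mul, eval_C, derivative_sub, derivative_mul,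
      derivative_C, zero_mul, zero_add] at h1 h2
    simp only [wronskian, eval_sub, eval_mul]
    linear_combination (derivative F.denom).eval z * h1 - F.denom.eval z * h2
  have hfib : fiber F w = ((↑) '' (R.roots.toFinset : Set ℂ) : Set (OnePoint ℂ)) := by
    ext p
    induction p using OnePoint.rec with
    | infty => simpa [mem_fiber] using hinf
    | coe z =>
      rw [coe_mem_fiber_coe, OnePoint.coe_injective.mem_set_image]
      simp [hR0, ← hR]
  rw [IsNoncriticalValue, hfib, OnePoint.coe_injective.encard_image,
    Set.encard_coe_eq_coe_finsetCard, Multiset.toFinset_card_of_nodup hnodup, ← hdeg,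
    IsAlgClosed.card_roots_eq_natDegree]

theorem finite_critical {F : RatFunc ℂ} (hF : degree F ≠ 0) :
    {w | ¬ IsNoncriticalValue F w}.Finite := by
  have hW : wronskian F.num F.denom ≠ 0 := by
    intro h
    -- For coprime polynomials the Wronskian vanishes only if both derivatives do, which makes F
    -- constant.
    rw [F.isCoprime_num_denom.wronskian_eq_zero_iff] at h
    apply hF
    rw [degree, derivative_eq_zero.1 h.1,
      derivative_eq_zero.1 h.2, max_self]
  have hfin : (insert ∞ (insert (sphereMap F ∞) ((fun z : ℂ => sphereMap F z) ''
      {z | (wronskian F.num F.denom).eval z = 0}))).Finite := by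
    refine Set.Finite.insert _ (Set.Finite.insert _ (Set.Finite.image _ ?_))
    exact Polynomial.finite_setOfPred_isRoot hW
  refine hfin.subset fun w hw => ?_
  by_contra hmem
  simp only [Set.mem_insert_iff, Set.mem_image, Set.mem_ofPred_eq, not_or, not_exists,
    not_and] at hmem
  apply hw
  induction w using OnePoint.rec with
  | infty => exact absurd rfl hmem.1
  | coe w => exact isNoncriticalValue_of_forall hF (Ne.symm hmem.2.1) hmem.2.2

theorem exists_isNoncriticalValue {F : RatFunc ℂ} (hF : degree F ≠ 0) {S : Set (OnePoint ℂ)}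
    (hS : S.Finite) : ∃ w, w ∉ S ∧ IsNoncriticalValue F w := by
  obtain ⟨w, hw⟩ := ((finite_critical hF).union hS).exists_notMem
  simp only [Set.mem_union, Set.mem_ofPred_eq, not_or, not_not] at hw
  exact ⟨w, hw.2, hw.1⟩

/-! ### Generic values of rational functions -/

/-- The value of a rational function at a point of the affine line (`0` at the poles). -/
def val (f : RatFunc ℂ) (z : ℂ) : ℂ := f.eval (RingHom.id ℂ) z

theorem val_eq (f : RatFunc ℂ) (z : ℂ) : val f z = f.num.eval z / f.denom.eval z := by
  simp [val, RatFunc.eval]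

theorem eventually_denom_ne_zero (f : RatFunc ℂ) : ∀ᶠ z in cofinite, f.denom.eval z ≠ 0 := by
  rw [eventually_cofinite]
  simp only [not_not]
  exact Polynomial.finite_setOfPred_isRoot f.denom_ne_zero

theorem sphereMap_eq_val {f : RatFunc ℂ} {z : ℂ} (h : f.denom.eval z ≠ 0) :
    sphereMap f z = (val f z : OnePoint ℂ) := by
  rw [sphereMap_coe, proj_of_ne h, val_eq]

theorem eventually_sphereMap_eq_val (f : RatFunc ℂ) :
    ∀ᶠ z : ℂ in cofinite, sphereMap f z = (val f z : OnePoint ℂ) :=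
  (eventually_denom_ne_zero f).mono fun _ => sphereMap_eq_val

theorem val_C (c z : ℂ) : val (RatFunc.C c) z = c := by simp [val]

theorem val_X (z : ℂ) : val RatFunc.X z = z := by simp [val]

theorem eventually_val_add (f g : RatFunc ℂ) :
    ∀ᶠ z in cofinite, val (f + g) z = val f z + val g z := by
  filter_upwards [eventually_denom_ne_zero f, eventually_denom_ne_zero g] with z hf hg
  exact RatFunc.eval_add _ _ (by simpa using hf) (by simpa using hg)

theorem eventually_val_mul (f g : RatFunc ℂ) :
    ∀ᶠ z in cofinite, val (f * g) z = val f z * val g z := by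
  filter_upwards [eventually_denom_ne_zero f, eventually_denom_ne_zero g] with z hf hg
  exact RatFunc.eval_mul _ _ (by simpa using hf) (by simpa using hg)

theorem eventually_val_inv (f : RatFunc ℂ) :
    ∀ᶠ z in cofinite, val f⁻¹ z = (val f z)⁻¹ := by
  by_cases hf : f = 0
  · subst hf
    simp [val]
  · filter_upwards [eventually_val_mul f f⁻¹] with z hz
    rw [mul_inv_cancel₀ hf] at hz
    have h1 : val (1 : RatFunc ℂ) z = 1 := by simp [val]
    rw [h1] at hz
    exact eq_inv_of_mul_eq_one_right hz.symm

theorem eventually_val_aeval (B : RatFunc ℂ) (p : ℂ[X]) :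
    ∀ᶠ z in cofinite, val (aeval B p) z = p.eval (val B z) := by
  induction p using Polynomial.induction_on' with
  | add p q hp hq =>
    filter_upwards [hp, hq, eventually_val_add (aeval B p) (aeval B q)] with z h1 h2 h3
    rw [map_add, h3, h1, h2, eval_add]
  | monomial n a =>
    simp only [aeval_monomial, eval_monomial]
    induction n with
    | zero =>
      simp only [pow_zero, mul_one]
      exact Eventually.of_forall fun z => val_C a z
    | succ n ih =>
      filter_upwards [ih, eventually_val_mul (algebraMap ℂ (RatFunc ℂ) a * B ^ n) B] with z h1 h2
      rw [pow_succ, ← mul_assoc, h2, h1, pow_succ, mul_assoc]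

theorem comp_eq (A B : RatFunc ℂ) : comp A B = aeval B A.num * (aeval B A.denom)⁻¹ := by
  rw [comp, RatFunc.eval, div_eq_mul_inv]
  rfl

theorem eventually_val_comp (A B : RatFunc ℂ) :
    ∀ᶠ z in cofinite, val (comp A B) z = val A (val B z) := by
  filter_upwards [eventually_val_aeval B A.num, eventually_val_aeval B A.denom,
    eventually_val_inv (aeval B A.denom),
    eventually_val_mul (aeval B A.num) (aeval B A.denom)⁻¹] with z h1 h2 h3 h4
  rw [comp_eq, h4, h3, h1, h2, val_eq A, div_eq_mul_inv]

/-- Each value is taken finitely often, so identities valid off a finite set can be pulled back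
along B. -/
theorem tendsto_val {B : RatFunc ℂ} (hB : degree B ≠ 0) : Tendsto (val B) cofinite cofinite := by
  refine Tendsto.cofinite_of_finite_preimage_singleton fun c => ?_
  have h := eventually_sphereMap_eq_val B
  rw [eventually_cofinite] at h
  refine (h.union ((finite_fiber hB c).preimage OnePoint.coe_injective.injOn)).subset ?_
  intro z hz
  by_cases hz' : sphereMap B z = (val B z : OnePoint ℂ)
  · right
    rw [Set.mem_preimage, mem_fiber, hz', show val B z = c from hz]
  · left
    exact hz'

theorem dense_of_cofinite {s : Set (OnePoint ℂ)} (hs : sᶜ.Finite) : Dense s := by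
  have h := dense_univ.sdiff_finite hs (X := OnePoint ℂ)
  rwa [← Set.compl_eq_univ_sdiff, compl_compl] at h

theorem eq_of_eventually_eq {f g : OnePoint ℂ → OnePoint ℂ} (hf : Continuous f)
    (hg : Continuous g) (h : ∀ᶠ z : ℂ in cofinite, f z = g z) : f = g := by
  refine Continuous.ext_on (s := {p | f p = g p}) (dense_of_cofinite ?_) hf hg fun p hp => hp
  rw [eventually_cofinite] at h
  refine ((h.image (↑)).insert ∞).subset fun p hp => ?_
  induction p using OnePoint.rec with
  | infty => exact Set.mem_insert _ _
  | coe z => exact Set.mem_insert_of_mem _ ⟨z, hp, rfl⟩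

/-- Both sides are continuous and agree off a finite set. A constant B whose value is a pole of A
must be excluded: there `comp` divides by zero and returns 0 instead of `∞`. -/
theorem sphereMap_comp (A : RatFunc ℂ) {B : RatFunc ℂ} (hB : degree B ≠ 0) (p : OnePoint ℂ) :
    sphereMap (comp A B) p = sphereMap A (sphereMap B p) := by
  refine congrFun (eq_of_eventually_eq (continuous_sphereMap _)
    ((continuous_sphereMap A).comp (continuous_sphereMap B)) ?_) p
  filter_upwards [eventually_sphereMap_eq_val (comp A B), eventually_val_comp A B,
    eventually_sphereMap_eq_val B, (tendsto_val hB).eventually (eventually_sphereMap_eq_val A)]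
    with z h1 h2 h3 h4
  rw [h1, h2, Function.comp_apply, h3, h4]

theorem sphereMap_X (p : OnePoint ℂ) : sphereMap RatFunc.X p = p := by
  refine congrFun (eq_of_eventually_eq (continuous_sphereMap _) continuous_id ?_) p
  filter_upwards [eventually_sphereMap_eq_val RatFunc.X] with z hz
  rw [hz, val_X, id]

theorem ext_val {f g : RatFunc ℂ} (h : ∀ᶠ z in cofinite, val f z = val g z) : f = g := by
  have h2 : ∀ᶠ z in cofinite, (f.num * g.denom - g.num * f.denom).eval z = 0 := by
    filter_upwards [h, eventually_denom_ne_zero f, eventually_denom_ne_zero g] with z h1 h2 h3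
    rw [val_eq, val_eq, div_eq_div_iff h2 h3] at h1
    simp [h1]
  have h3 : f.num * g.denom - g.num * f.denom = 0 := by
    refine Polynomial.eq_zero_of_infinite_isRoot _ ?_
    rw [eventually_cofinite] at h2
    have := h2.infinite_compl
    rwa [Set.compl_ofPred, show {a | ¬¬eval a (f.num * g.denom - g.num * f.denom) = 0} =
      {x | (f.num * g.denom - g.num * f.denom).IsRoot x} by ext; simp [IsRoot]] at this
  rw [← RatFunc.num_div_denom f, ← RatFunc.num_div_denom g,
    div_eq_div_iff (by simpa using f.denom_ne_zero) (by simpa using g.denom_ne_zero), ← map_mul,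
    ← map_mul, sub_eq_zero.1 h3]

/-! ### Composition and degree -/

theorem degree_eq_zero_iff {F : RatFunc ℂ} : degree F = 0 ↔ ∃ c, F = RatFunc.C c := by
  rw [degree, Nat.max_eq_zero_iff, RatFunc.eq_C_iff]

theorem degree_X : degree RatFunc.X = 1 := by simp [degree]

theorem degree_C (c : ℂ) : degree (RatFunc.C c) = 0 := degree_eq_zero_iff.2 ⟨c, rfl⟩

theorem comp_C (A : RatFunc ℂ) (c : ℂ) : comp A (RatFunc.C c) = RatFunc.C (val A c) := by
  refine ext_val ?_
  filter_upwards [eventually_val_comp A (RatFunc.C c)] with z hz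
  rw [hz, val_C, val_C]

theorem C_comp (c : ℂ) (B : RatFunc ℂ) : comp (RatFunc.C c) B = RatFunc.C c := by
  refine ext_val ?_
  filter_upwards [eventually_val_comp (RatFunc.C c) B] with z hz
  rw [hz, val_C, val_C]

theorem degree_ne_zero_of_comp {A B : RatFunc ℂ} (h : degree (comp A B) ≠ 0) :
    degree A ≠ 0 ∧ degree B ≠ 0 := by
  constructor
  · intro hA
    obtain ⟨c, rfl⟩ := degree_eq_zero_iff.1 hA
    exact h (by rw [C_comp, degree_C])
  · intro hB
    obtain ⟨c, rfl⟩ := degree_eq_zero_iff.1 hB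
    exact h (by rw [comp_C, degree_C])

theorem comp_X (A : RatFunc ℂ) : comp A RatFunc.X = A := by
  refine ext_val ?_
  filter_upwards [eventually_val_comp A RatFunc.X] with z hz
  rw [hz, val_X]

theorem X_comp (A : RatFunc ℂ) : comp RatFunc.X A = A := by
  refine ext_val ?_
  filter_upwards [eventually_val_comp RatFunc.X A] with z hz
  rw [hz, val_X]

theorem comp_assoc (A B : RatFunc ℂ) {D : RatFunc ℂ} (hD : degree D ≠ 0) :
    comp (comp A B) D = comp A (comp B D) := by
  refine ext_val ?_
  filter_upwards [eventually_val_comp (comp A B) D, eventually_val_comp A (comp B D),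
    eventually_val_comp B D, (tendsto_val hD).eventually (eventually_val_comp A B)]
    with z h1 h2 h3 h4
  rw [h1, h2, h3, h4]

theorem comp_right_cancel {A B D : RatFunc ℂ} (hD : degree D ≠ 0) (h : comp A D = comp B D) :
    A = B := by
  have hs : ∀ p, sphereMap A p = sphereMap B p := by
    intro p
    obtain ⟨q, rfl⟩ := surjective_sphereMap hD p
    rw [← sphereMap_comp A hD, ← sphereMap_comp B hD, h]
  refine ext_val ?_
  filter_upwards [eventually_sphereMap_eq_val A, eventually_sphereMap_eq_val B] with z h1 h2
  rw [← OnePoint.coe_eq_coe, ← h1, ← h2, hs]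

theorem fiber_comp (A : RatFunc ℂ) {B : RatFunc ℂ} (hB : degree B ≠ 0) (w : OnePoint ℂ) :
    fiber (comp A B) w = ⋃ y ∈ fiber A w, fiber B y := by
  ext p
  simp [mem_fiber, sphereMap_comp A hB]

theorem ncard_fiber_le {F : RatFunc ℂ} (hF : degree F ≠ 0) (w : OnePoint ℂ) :
    (fiber F w).ncard ≤ degree F := by
  rw [Set.ncard, ← Nat.cast_le (α := ℕ∞), ENat.natCast_toNat]
  · exact encard_fiber_le hF w
  · exact (finite_fiber hF w).encard_lt_top.ne

theorem isNoncriticalValue_iff {F : RatFunc ℂ} (hF : degree F ≠ 0) (w : OnePoint ℂ) :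
    IsNoncriticalValue F w ↔ (fiber F w).ncard = degree F := by
  rw [IsNoncriticalValue, ← (finite_fiber hF w).cast_ncard_eq, Nat.cast_inj]

theorem ncard_fiber_comp (A : RatFunc ℂ) {B : RatFunc ℂ} (hA : degree A ≠ 0) (hB : degree B ≠ 0)
    (w : OnePoint ℂ) :
    (fiber (comp A B) w).ncard = ∑ y ∈ (finite_fiber hA w).toFinset, (fiber B y).ncard := by
  classical
  have h1 : fiber (comp A B) w =
      ((finite_fiber hA w).toFinset.biUnion fun y => (finite_fiber hB y).toFinset : Finset _) := by
    rw [fiber_comp A hB]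
    ext p
    simp
  rw [h1, Set.ncard_coe_finset, Finset.card_biUnion]
  · refine Finset.sum_congr rfl fun y _ => ?_
    rw [Set.ncard_eq_toFinset_card _ (finite_fiber hB y)]
  · intro y _ y' _ hne
    rw [Function.onFun, Finset.disjoint_left]
    intro p hp hp'
    simp only [Set.Finite.mem_toFinset, mem_fiber] at hp hp'
    exact hne (hp.symm.trans hp')

/-- Preimages are counted over a value that is non-critical for A ∘ B and for A, and whose preimages
under A are all non-critical for B. -/
theorem degree_comp {A B : RatFunc ℂ} (hA : degree A ≠ 0) (hB : degree B ≠ 0) :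
    degree (comp A B) = degree A * degree B := by
  by_cases hAB : degree (comp A B) = 0
  · exfalso
    obtain ⟨c, hc⟩ := degree_eq_zero_iff.1 hAB
    rw [← C_comp c B] at hc
    exact hA (by rw [comp_right_cancel hB hc, degree_C])
  have hfin : (({w | ¬ IsNoncriticalValue A w}) ∪
      sphereMap A '' {y | ¬ IsNoncriticalValue B y}).Finite :=
    (finite_critical hA).union ((finite_critical hB).image _)
  obtain ⟨w, hw, hwAB⟩ := exists_isNoncriticalValue hAB hfin
  simp only [Set.mem_union, Set.mem_ofPred_eq, not_or, not_not, Set.mem_image, not_exists,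
    not_and] at hw
  rw [isNoncriticalValue_iff hAB, ncard_fiber_comp A hA hB] at hwAB
  rw [← hwAB, Finset.sum_congr rfl (g := fun _ => degree B), Finset.sum_const, smul_eq_mul,
    ← Set.ncard_eq_toFinset_card _ (finite_fiber hA w), (isNoncriticalValue_iff hA w).1 hw.1]
  intro y hy
  rw [Set.Finite.mem_toFinset, mem_fiber] at hy
  rw [← isNoncriticalValue_iff hB]
  by_contra h
  exact hw.2 y h hy

theorem degree_comp_ne_zero {A B : RatFunc ℂ} (hA : degree A ≠ 0) (hB : degree B ≠ 0) :
    degree (comp A B) ≠ 0 := by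
  rw [degree_comp hA hB]
  exact mul_ne_zero hA hB

/-- The fibre has deg A · deg B points, spread over at most deg A fibres of B with at most deg B
points each; equality must hold in every bound. -/
theorem IsNoncriticalValue.of_comp {A B : RatFunc ℂ} (hA : degree A ≠ 0) (hB : degree B ≠ 0)
    {w : OnePoint ℂ} (hw : IsNoncriticalValue (comp A B) w) :
    IsNoncriticalValue A w ∧ ∀ y ∈ fiber A w, IsNoncriticalValue B y := by
  rw [isNoncriticalValue_iff (degree_comp_ne_zero hA hB), ncard_fiber_comp A hA hB,
    degree_comp hA hB] at hw
  have hle : ∀ y ∈ (finite_fiber hA w).toFinset, (fiber B y).ncard ≤ degree B :=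
    fun y _ => ncard_fiber_le hB y
  have hA' := ncard_fiber_le hA w
  have hcard := Set.ncard_eq_toFinset_card _ (finite_fiber hA w)
  have h1 : ∑ y ∈ (finite_fiber hA w).toFinset, (fiber B y).ncard ≤
      (fiber A w).ncard * degree B := by
    rw [hcard]
    simpa using Finset.sum_le_sum hle
  have h2 : (fiber A w).ncard = degree A := by
    refine le_antisymm hA' (Nat.le_of_mul_le_mul_right (hw ▸ h1) (Nat.pos_of_ne_zero hB))
  refine ⟨(isNoncriticalValue_iff hA w).2 h2, fun y hy => ?_⟩
  rw [isNoncriticalValue_iff hB]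
  refine (Finset.sum_eq_sum_iff_of_le hle).1 ?_ y (by simpa using hy)
  rw [hw, Finset.sum_const, smul_eq_mul, ← hcard, h2]

end RatDecomp

end

noncomputable section

namespace RatDecomp

open Filter Topology Polynomial unitInterval

/-! ### The covering over the non-critical values -/

/-- If injectivity failed near x, a nearby value would have one preimage close to each of the deg F
points of the fibre and a further one close to x. -/
theorem exists_injOn_nhds {F : RatFunc ℂ} (hF : degree F ≠ 0) {x : OnePoint ℂ}
    (hx : IsNoncriticalValue F (sphereMap F x)) :
    ∃ V : Set (OnePoint ℂ), IsOpen V ∧ x ∈ V ∧ Set.InjOn (sphereMap F) V := by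
  classical
  set w := sphereMap F x with hw
  have hfin := finite_fiber hF w
  obtain ⟨V, hV, hdisj⟩ := hfin.t2_separation
  have hUopen : IsOpen (⋂ y ∈ fiber F w, sphereMap F '' V y) :=
    hfin.isOpen_biInter fun y _ => isOpenMap_sphereMap hF _ (hV y).2
  refine ⟨V x ∩ sphereMap F ⁻¹' (⋂ y ∈ fiber F w, sphereMap F '' V y),
    (hV x).2.inter (hUopen.preimage (continuous_sphereMap F)), ⟨(hV x).1, ?_⟩, ?_⟩
  · simp only [Set.mem_preimage, Set.mem_iInter]
    exact fun y hy => ⟨y, (hV y).1, hy⟩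
  rintro p ⟨hpV, hpU⟩ q ⟨hqV, -⟩ hpq
  by_contra hne
  simp only [Set.mem_preimage, Set.mem_iInter] at hpU
  choose! v hvV hvp using hpU
  have hxw : x ∈ fiber F w := hw.symm
  -- One preimage of F(p) is selected in each `V y`, with p itself in `V x`; then q is the surplus
  -- preimage.
  let s : OnePoint ℂ → OnePoint ℂ := fun y => if y = x then p else v y
  have hsV : ∀ y ∈ fiber F w, s y ∈ V y := by
    intro y hy
    by_cases h : y = x
    · subst h
      simpa only [s, if_true] using hpV
    · simp only [s, if_neg h, hvV y hy]
  have hsF : ∀ y ∈ fiber F w, sphereMap F (s y) = sphereMap F p := by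
    intro y hy
    by_cases h : y = x
    · simp only [s, if_pos h]
    · simp only [s, if_neg h, hvp y hy]
  have hinj : Set.InjOn s (fiber F w) := by
    intro y hy y' hy' h
    by_contra hyy'
    exact Set.disjoint_left.1 (hdisj hy hy' hyy') (hsV y hy) (h ▸ hsV y' hy')
  have hq : q ∉ s '' fiber F w := by
    rintro ⟨y, hy, rfl⟩
    by_cases h : y = x
    · exact hne (by simp only [s, if_pos h])
    · exact Set.disjoint_left.1 (hdisj hy hxw h) (hsV y hy) hqV
  have hsub : insert q (s '' fiber F w) ⊆ fiber F (sphereMap F p) := by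
    rw [Set.insert_subset_iff]
    refine ⟨hpq.symm, ?_⟩
    rintro _ ⟨y, hy, rfl⟩
    exact hsF y hy
  have hcard := (Set.encard_le_encard hsub).trans (encard_fiber_le hF _)
  rw [Set.encard_insert_of_notMem hq, hinj.encard_image, hx] at hcard
  have : degree F + 1 ≤ degree F := by exact_mod_cast hcard
  omega

/-- The set of non-critical values. -/
def noncritical (F : RatFunc ℂ) : Set (OnePoint ℂ) := {w | IsNoncriticalValue F w}

theorem isCoveringMapOn_sphereMap {F : RatFunc ℂ} (hF : degree F ≠ 0) :
    IsCoveringMapOn (sphereMap F) (noncritical F) := by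
  refine IsCoveringMapOn.of_isLocalHomeomorphOn (continuous_sphereMap F) ?_
  refine IsLocalHomeomorphOn.mk _ _ fun x hx => ?_
  obtain ⟨V, hVo, hxV, hinj⟩ := exists_injOn_nhds hF hx
  refine ⟨OpenPartialHomeomorph.ofContinuousOpen
    ((hinj.bijOn_image).toPartialEquiv _ _ _) ?_ ?_ ?_, hxV, fun _ _ => rfl⟩
  · exact (continuous_sphereMap F).continuousOn
  · exact isOpenMap_sphereMap hF
  · exact hVo

theorem isCoveringMap_restrict {F : RatFunc ℂ} (hF : degree F ≠ 0) :
    IsCoveringMap ((noncritical F).restrictPreimage (sphereMap F)) :=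
  (isCoveringMapOn_sphereMap hF).isCoveringMap_restrictPreimage

theorem isOpen_of_finite_compl {S : Set (OnePoint ℂ)} (hS : Sᶜ.Finite) : IsOpen S := by
  rw [← isClosed_compl_iff]
  exact hS.isClosed

theorem isOpen_noncritical {F : RatFunc ℂ} (hF : degree F ≠ 0) : IsOpen (noncritical F) :=
  isOpen_of_finite_compl (finite_critical hF)

theorem eq_of_sphereMap_comp_eq {F : RatFunc ℂ} (hF : degree F ≠ 0) {A : Type*}
    [TopologicalSpace A] [PreconnectedSpace A] {g h : A → OnePoint ℂ} (hg : Continuous g)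
    (hh : Continuous h) (hgN : ∀ t, IsNoncriticalValue F (sphereMap F (g t)))
    (hgh : ∀ t, sphereMap F (g t) = sphereMap F (h t)) {t₀ : A} (h0 : g t₀ = h t₀) : g = h := by
  let g' : A → sphereMap F ⁻¹' noncritical F := fun t => ⟨g t, hgN t⟩
  let h' : A → sphereMap F ⁻¹' noncritical F := fun t => ⟨h t, by
    rw [Set.mem_preimage, ← hgh]; exact hgN t⟩
  have key : g' = h' := by
    refine (isCoveringMap_restrict hF).eq_of_comp_eq (hg.subtype_mk _) (hh.subtype_mk _) ?_ t₀
      (Subtype.ext h0)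
    funext t
    exact Subtype.ext (hgh t)
  funext t
  exact congrArg Subtype.val (congrFun key t)

theorem exists_lift {F : RatFunc ℂ} (hF : degree F ≠ 0) {a b : OnePoint ℂ} (γ : Path a b)
    (hγ : ∀ t, IsNoncriticalValue F (γ t)) (x : fiber F a) :
    ∃ y : fiber F b, ∃ Γ : Path (x : OnePoint ℂ) (y : OnePoint ℂ),
      ∀ t, sphereMap F (Γ t) = γ t := by
  let γ' : C(I, noncritical F) := ⟨fun t => ⟨γ t, hγ t⟩, by fun_prop⟩
  have hx : sphereMap F x = a := x.2
  let e : sphereMap F ⁻¹' noncritical F := ⟨x, by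
    rw [Set.mem_preimage, hx, ← γ.source]; exact hγ 0⟩
  obtain ⟨Γ, hΓ, hΓ0⟩ := (isCoveringMap_restrict hF).exists_path_lifts γ' e
    (Subtype.ext (by simp [γ', e, hx]))
  have hl : ∀ t, sphereMap F (Γ t : OnePoint ℂ) = γ t := fun t =>
    congrArg Subtype.val (congrFun hΓ t)
  refine ⟨⟨Γ 1, (hl 1).trans γ.target⟩, ⟨⟨fun t => (Γ t : OnePoint ℂ), by fun_prop⟩, ?_, rfl⟩, hl⟩
  change (Γ 0 : OnePoint ℂ) = x
  rw [hΓ0]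

theorem lift_unique {F : RatFunc ℂ} (hF : degree F ≠ 0) {a b : OnePoint ℂ} {γ : Path a b}
    (hγ : ∀ t, IsNoncriticalValue F (γ t)) {x y z : OnePoint ℂ} {Γ : Path x y} {Δ : Path x z}
    (hΓ : ∀ t, sphereMap F (Γ t) = γ t) (hΔ : ∀ t, sphereMap F (Δ t) = γ t) :
    (∀ t, Γ t = Δ t) ∧ y = z := by
  have h : (Γ : I → OnePoint ℂ) = Δ := by
    refine eq_of_sphereMap_comp_eq hF Γ.continuous Δ.continuous (fun t => ?_) (fun t => ?_)
      (t₀ := 0) (by simp)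
    · rw [hΓ]; exact hγ t
    · rw [hΓ, hΔ]
  refine ⟨congrFun h, ?_⟩
  simpa using congrFun h 1

/-! ### Transport along paths -/

/-- The bijection `e` of fibers is induced by lifting the path `γ`. -/
def IsTransport (F : RatFunc ℂ) {a b : OnePoint ℂ} (γ : Path a b) (e : fiber F a ≃ fiber F b) :
    Prop :=
  ∀ x : fiber F a, ∃ Γ : Path (x : OnePoint ℂ) (e x : OnePoint ℂ), ∀ t, sphereMap F (Γ t) = γ t

theorem IsTransport.symm {F : RatFunc ℂ} {a b : OnePoint ℂ} {γ : Path a b}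
    {e : fiber F a ≃ fiber F b} (h : IsTransport F γ e) : IsTransport F γ.symm e.symm := by
  intro x
  obtain ⟨Γ, hΓ⟩ := h (e.symm x)
  refine ⟨Γ.symm.cast (by simp) rfl, fun t => ?_⟩
  simpa using hΓ (σ t)

theorem IsTransport.trans {F : RatFunc ℂ} {a b c : OnePoint ℂ} {γ : Path a b} {δ : Path b c}
    {e : fiber F a ≃ fiber F b} {f : fiber F b ≃ fiber F c} (h : IsTransport F γ e)
    (h' : IsTransport F δ f) : IsTransport F (γ.trans δ) (e.trans f) := by
  intro x
  obtain ⟨Γ, hΓ⟩ := h x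
  obtain ⟨Δ, hΔ⟩ := h' (e x)
  rw [Equiv.trans_apply]
  refine ⟨Γ.trans Δ, fun t => ?_⟩
  rw [Path.trans_apply, Path.trans_apply]
  split_ifs
  · exact hΓ _
  · exact hΔ _

theorem IsTransport.apply_eq {F : RatFunc ℂ} (hF : degree F ≠ 0) {a b : OnePoint ℂ}
    {γ : Path a b} (hγ : ∀ t, IsNoncriticalValue F (γ t)) {e : fiber F a ≃ fiber F b}
    (h : IsTransport F γ e) {x : fiber F a} {y : OnePoint ℂ} {Γ : Path (x : OnePoint ℂ) y}
    (hΓ : ∀ t, sphereMap F (Γ t) = γ t) : (e x : OnePoint ℂ) = y := by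
  obtain ⟨Δ, hΔ⟩ := h x
  exact (lift_unique hF hγ hΔ hΓ).2

/-- The inverse bijection lifts the reversed path; uniqueness of lifts shows that the two are
mutually inverse. -/
theorem exists_isTransport {F : RatFunc ℂ} (hF : degree F ≠ 0) {a b : OnePoint ℂ}
    (γ : Path a b) (hγ : ∀ t, IsNoncriticalValue F (γ t)) :
    ∃ e : fiber F a ≃ fiber F b, IsTransport F γ e := by
  choose f Γ hΓ using exists_lift hF γ hγ
  choose g Δ hΔ using exists_lift hF γ.symm (fun t => hγ (σ t))
  refine ⟨⟨f, g, fun x => Subtype.ext ?_, fun y => Subtype.ext ?_⟩, fun x => ⟨Γ x, hΓ x⟩⟩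
  · refine (lift_unique hF (γ := γ.symm) (fun t => hγ (σ t)) (hΔ (f x)) (Δ := (Γ x).symm) ?_).2
    intro t
    simpa using hΓ x (σ t)
  · refine (lift_unique hF (γ := γ) hγ (hΓ (g y)) (Δ := (Δ y).symm) ?_).2
    intro t
    simpa using hΔ y (σ t)

/-! ### Paths avoiding finite sets -/

theorem exists_chart (p : OnePoint ℂ) :
    ∃ ψ : ℂ → OnePoint ℂ, IsOpenEmbedding ψ ∧ ∃ q, ψ q = p := by
  induction p using OnePoint.rec with
  | infty =>
    refine ⟨fun s => proj 1 s, ?_, 0, proj_zero 1⟩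
    exact inversionHomeo.isOpenEmbedding.comp OnePoint.isOpenEmbedding_coe
  | coe z => exact ⟨(↑), OnePoint.isOpenEmbedding_coe, z, rfl⟩

/-- Polar coordinates present the set as a continuous image of an interval times a circle. -/
theorem isPathConnected_punctured_ball (q : ℂ) {r : ℝ} (hr : 0 < r) :
    IsPathConnected (Metric.ball q r \ {q}) := by
  have hset : Metric.ball q r \ {q} =
      (fun v : ℝ × ℂ => q + v.1 * v.2) '' (Set.Ioo 0 r ×ˢ Metric.sphere (0 : ℂ) 1) := by
    ext z
    simp only [Set.mem_sdiff, Metric.mem_ball, Set.mem_singleton_iff, Set.mem_image, Set.mem_prod,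
      Set.mem_Ioo, mem_sphere_zero_iff_norm, Prod.exists, dist_eq_norm]
    constructor
    · rintro ⟨h1, h2⟩
      have h3 : ‖z - q‖ ≠ 0 := norm_ne_zero_iff.2 (sub_ne_zero.2 h2)
      refine ⟨‖z - q‖, (z - q) / ‖z - q‖, ⟨⟨(norm_nonneg _).lt_of_ne' h3, h1⟩, ?_⟩, ?_⟩
      · rw [norm_div, Complex.norm_real, norm_norm, div_self h3]
      · rw [mul_div_cancel₀ _ (by exact_mod_cast h3), add_sub_cancel]
    · rintro ⟨t, v, ⟨⟨h1, h2⟩, h3⟩, rfl⟩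
      have hv : v ≠ 0 := by
        rintro rfl
        simp at h3
      constructor
      · rw [add_sub_cancel_left, norm_mul, h3, mul_one, Complex.norm_real, Real.norm_eq_abs,
          abs_of_pos h1]
        exact h2
      · simp [h1.ne', hv]
  rw [hset]
  refine IsPathConnected.image (IsPathConnected.prod ?_ ?_) (by fun_prop)
  · exact (convex_Ioo 0 r).isPathConnected (Set.nonempty_Ioo.2 hr)
  · exact isPathConnected_sphere (by simp [Complex.rank_real_complex]) _ zero_le_one

/-- Every neighborhood of a point of the sphere contains an open neighborhood which stays
path-connected and dense when a given finite set is removed. -/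
theorem exists_nhds_diff_isPathConnected {S : Set (OnePoint ℂ)} (hS : S.Finite)
    {p : OnePoint ℂ} {W : Set (OnePoint ℂ)} (hW : W ∈ 𝓝 p) :
    ∃ U ⊆ W, IsOpen U ∧ p ∈ U ∧ IsPathConnected (U \ S) := by
  obtain ⟨ψ, hψ, q, rfl⟩ := exists_chart p
  -- The disc is shrunk until its centre is the only point that can lie in S.
  have h1 : ψ ⁻¹' (W ∩ (S \ {ψ q})ᶜ) ∈ 𝓝 q := by
    refine hψ.continuous.continuousAt.preimage_mem_nhds (inter_mem hW ?_)
    exact (hS.subset Set.sdiff_subset).isClosed.isOpen_compl.mem_nhds (by simp)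
  obtain ⟨r, hr, hball⟩ := Metric.mem_nhds_iff.1 h1
  refine ⟨ψ '' Metric.ball q r, ?_, hψ.isOpenMap _ Metric.isOpen_ball,
    ⟨q, Metric.mem_ball_self hr, rfl⟩, ?_⟩
  · rintro _ ⟨z, hz, rfl⟩
    exact (hball hz).1
  by_cases hq : ψ q ∈ S
  · have : ψ '' Metric.ball q r \ S = ψ '' (Metric.ball q r \ {q}) := by
      ext y
      constructor
      · rintro ⟨⟨z, hz, rfl⟩, h2⟩
        refine ⟨z, ⟨hz, ?_⟩, rfl⟩
        rintro rfl
        exact h2 hq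
      · rintro ⟨z, ⟨hz, hzq⟩, rfl⟩
        refine ⟨⟨z, hz, rfl⟩, fun hzS => (hball hz).2 ⟨hzS, fun h => hzq (hψ.injective h)⟩⟩
    rw [this]
    exact (isPathConnected_punctured_ball q hr).image hψ.continuous
  · have : ψ '' Metric.ball q r \ S = ψ '' Metric.ball q r := by
      ext y
      constructor
      · exact fun h => h.1
      · rintro ⟨z, hz, rfl⟩
        refine ⟨⟨z, hz, rfl⟩, fun hzS => (hball hz).2 ⟨hzS, fun h => hq ?_⟩⟩
        rwa [Set.mem_singleton_iff.1 h] at hzS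
    rw [this]
    exact (Metric.isPathConnected_ball hr).image hψ.continuous

end RatDecomp

end

/-! ### Pushing a path off a finite set without changing its transport -/

noncomputable section

namespace RatDecomp

open Filter Topology Polynomial unitInterval

/-- The pairs `(c, f)` such that some path from `a` to `c` through non-critical values outside `S`
lifts, from each point `x` over `a`, to a path ending at `f x`. -/
def reachable (F : RatFunc ℂ) (a : OnePoint ℂ) (S : Set (OnePoint ℂ)) :
    Set (OnePoint ℂ × (fiber F a → OnePoint ℂ)) :=
  {v | ∃ γ : Path a v.1, (∀ t, IsNoncriticalValue F (γ t) ∧ γ t ∉ S) ∧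
    ∀ x : fiber F a, ∃ Γ : Path (x : OnePoint ℂ) (v.2 x), ∀ t, sphereMap F (Γ t) = γ t}

/-- Near p there are local sections of F through all the points `f x`. From one reachable pair in
this neighbourhood the path can be continued inside `U \ S`, which is path-connected, and lifted by
the sections. This reaches every compatible pair off S, and those over S as limits. -/
theorem exists_local_reachable {F : RatFunc ℂ} (hF : degree F ≠ 0) {a : OnePoint ℂ}
    {S : Set (OnePoint ℂ)} (hS : S.Finite) {p : OnePoint ℂ} (hp : IsNoncriticalValue F p)
    {f : fiber F a → OnePoint ℂ} (hf : ∀ x, sphereMap F (f x) = p) :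
    ∃ O : Set (OnePoint ℂ × (fiber F a → OnePoint ℂ)), IsOpen O ∧ (p, f) ∈ O ∧
      ((reachable F a S ∩ O).Nonempty →
        ∀ v ∈ O, (∀ x, sphereMap F (v.2 x) = v.1) → v ∈ closure (reachable F a S) ∧
          (v.1 ∉ S → v ∈ reachable F a S)) := by
  have : Finite (fiber F a) := finite_fiber hF a
  have hloc := (isCoveringMapOn_sphereMap hF).isLocalHomeomorphOn
  choose h hmem heq using fun x : fiber F a => hloc (f x) (by
    rw [Set.mem_preimage, hf x]; exact hp)
  have hF' : ∀ x, ∀ y, h x y = sphereMap F y := fun x y => by rw [heq x]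
  have hW : (⋂ x, (h x).target) ∩ noncritical F ∈ 𝓝 p := by
    refine inter_mem (Filter.iInter_mem.2 fun x => ?_) ((isOpen_noncritical hF).mem_nhds hp)
    refine (h x).open_target.mem_nhds ?_
    have := (h x).map_source (hmem x)
    rwa [hF', hf] at this
  obtain ⟨U, hUW, hUo, hpU, hUS⟩ := exists_nhds_diff_isPathConnected hS hW
  have htgt : ∀ x, U ⊆ (h x).target := fun x c hc => Set.mem_iInter.1 (hUW hc).1 x
  have hsec : ∀ x y, y ∈ (h x).source → (h x).symm (sphereMap F y) = y := fun x y hy => by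
    rw [← hF' x y]; exact (h x).left_inv hy
  have hsec' : ∀ x, ∀ c ∈ U, sphereMap F ((h x).symm c) = c := fun x c hc => by
    rw [← hF' x]; exact (h x).right_inv (htgt x hc)
  refine ⟨U ×ˢ Set.univ.pi fun x => (h x).source,
    hUo.prod (isOpen_set_pi Set.finite_univ fun x _ => (h x).open_source),
    ⟨hpU, fun x _ => hmem x⟩, ?_⟩
  rintro ⟨⟨c', f'⟩, ⟨γ, hγ, hΓ⟩, hc', hf'⟩
  simp only at γ hγ hΓ hc' hf'
  have hc'S : c' ∉ S := by simpa using (hγ 1).2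
  have hf'F : ∀ x, sphereMap F (f' x) = c' := fun x => by
    obtain ⟨Γ, hΓ⟩ := hΓ x
    simpa using hΓ 1
  have key : ∀ c ∈ U \ S, (c, fun x => (h x).symm c) ∈ reachable F a S := by
    rintro c hc
    obtain ⟨δ, hδ⟩ := hUS.joinedIn c' ⟨hc', hc'S⟩ c hc
    refine ⟨γ.trans δ, fun t => ?_, fun x => ?_⟩
    · rw [Path.trans_apply]
      split_ifs
      · exact hγ _
      · exact ⟨(hUW (hδ _).1).2, (hδ _).2⟩
    · obtain ⟨Γ, hΓ⟩ := hΓ x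
      have hst : (h x).symm c' = f' x := by
        rw [← hf'F x]; exact hsec x _ (hf' x trivial)
      have hcont : ContinuousOn (h x).symm (Set.range δ) :=
        (h x).continuousOn_symm.mono (by rintro _ ⟨t, rfl⟩; exact htgt x (hδ t).1)
      let Δ : Path (f' x) ((h x).symm c) := (δ.map' hcont).cast hst.symm rfl
      refine ⟨Γ.trans Δ, fun t => ?_⟩
      rw [Path.trans_apply, Path.trans_apply]
      split_ifs
      · exact hΓ _
      · exact hsec' x _ (hδ _).1
  rintro ⟨c, g⟩ ⟨hc, hg⟩ hgF
  simp only at hc hg hgF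
  -- Lying in the sources of the local charts forces g to consist of the values of the sections.
  have hgs : g = fun x => (h x).symm c := by
    funext x
    rw [← hgF x]
    exact (hsec x _ (hg x trivial)).symm
  refine ⟨?_, fun hcS => hgs ▸ key c ⟨hc, hcS⟩⟩
  have hcl : c ∈ closure (U \ S) := by
    have := (dense_of_cofinite (s := Sᶜ) (by simpa using hS)).open_subset_closure_inter hUo hc
    rwa [← Set.sdiff_eq] at this
  have hcont : ContinuousWithinAt (fun c => (c, fun x : fiber F a => (h x).symm c)) (U \ S) c := by
    refine continuousWithinAt_id.prodMk (continuousWithinAt_pi.2 fun x => ?_)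
    exact ((h x).continuousOn_symm c (htgt x hc)).mono (Set.sdiff_subset.trans (htgt x))
  rw [hgs]
  exact hcont.mem_closure hcl fun c hc => key c hc

/-- A connectedness argument on the unit interval replaces homotopies: the times at which γ and its
lifts lie in the closure of `reachable` form a clopen set containing 0. The closure is needed
because γ may meet S on the way; at the endpoint b, which is not in S, it can be dropped. -/
theorem exists_transport_avoiding {F : RatFunc ℂ} (hF : degree F ≠ 0) {a b : OnePoint ℂ}
    {γ : Path a b} (hγ : ∀ t, IsNoncriticalValue F (γ t)) {S : Set (OnePoint ℂ)} (hS : S.Finite)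
    (ha : a ∉ S) (hb : b ∉ S) {e : fiber F a ≃ fiber F b} (he : IsTransport F γ e) :
    ∃ δ : Path a b, (∀ t, IsNoncriticalValue F (δ t) ∧ δ t ∉ S) ∧ IsTransport F δ e := by
  choose Γ hΓ using he
  let v : I → OnePoint ℂ × (fiber F a → OnePoint ℂ) := fun t => (γ t, fun x => Γ x t)
  have hv : Continuous v := by fun_prop
  have hloc := fun t => exists_local_reachable hF hS (hγ t) (f := fun x => Γ x t)
    (fun x => hΓ x t)
  have hclopen : IsClopen {t | v t ∈ closure (reachable F a S)} := by
    refine ⟨isClosed_closure.preimage hv, isOpen_iff_mem_nhds.2 fun t ht => ?_⟩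
    obtain ⟨O, hO, htO, hOr⟩ := hloc t
    have hne : (reachable F a S ∩ O).Nonempty := by
      rw [Set.inter_comm]
      exact mem_closure_iff.1 ht O hO htO
    filter_upwards [(hO.preimage hv).mem_nhds htO] with t' ht'
    exact (hOr hne _ ht' fun x => hΓ x t').1
  have h0 : (0 : I) ∈ {t | v t ∈ closure (reachable F a S)} := by
    refine subset_closure ⟨(Path.refl a).cast rfl γ.source, fun t => ?_, fun x => ?_⟩
    · exact ⟨by simpa using hγ 0, ha⟩
    · exact ⟨(Path.refl _).cast rfl (Γ x).source, fun t => x.2⟩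
  have h1 : (1 : I) ∈ {t | v t ∈ closure (reachable F a S)} := by
    rw [hclopen.eq_univ ⟨0, h0⟩]
    trivial
  obtain ⟨O, hO, htO, hOr⟩ := hloc 1
  have hne : (reachable F a S ∩ O).Nonempty := by
    rw [Set.inter_comm]
    exact mem_closure_iff.1 h1 O hO htO
  obtain ⟨δ, hδ, hΔ⟩ := (hOr hne _ htO fun x => hΓ x 1).2 (by rwa [γ.target])
  refine ⟨δ.cast rfl γ.target.symm, hδ, fun x => ?_⟩
  obtain ⟨Δ, hΔ⟩ := hΔ x
  exact ⟨Δ.cast rfl (Γ x).target.symm, hΔ⟩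

theorem isNoncriticalValue_of_degree_one {F : RatFunc ℂ} (hF : degree F = 1) (w : OnePoint ℂ) :
    IsNoncriticalValue F w := by
  have h0 : degree F ≠ 0 := by omega
  refine le_antisymm (encard_fiber_le h0 w) ?_
  rw [hF, Nat.cast_one, Set.one_le_encard_iff_nonempty]
  exact surjective_sphereMap h0 w

theorem joined_sphere (p q : OnePoint ℂ) : Joined p q := by
  have h0 : ∀ p : OnePoint ℂ, Joined ((1 : ℂ) : OnePoint ℂ) p := by
    intro p
    induction p using OnePoint.rec with
    | infty =>
      have h := (PathConnectedSpace.joined (1 : ℂ) 0).map continuous_proj_one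
      rwa [proj_zero, proj_one] at h
    | coe z => exact (PathConnectedSpace.joined (1 : ℂ) z).map OnePoint.continuous_coe
  exact (h0 p).symm.trans (h0 q)

/-- The previous theorem is applied to the identity map, which has no critical values. -/
theorem exists_path_avoiding {S : Set (OnePoint ℂ)} (hS : S.Finite) {a b : OnePoint ℂ}
    (ha : a ∉ S) (hb : b ∉ S) : ∃ γ : Path a b, ∀ t, γ t ∉ S := by
  have hX : degree RatFunc.X ≠ 0 := by simp [degree_X]
  let γ : Path a b := (joined_sphere a b).somePath
  obtain ⟨e, he⟩ := exists_isTransport hX γ fun t => isNoncriticalValue_of_degree_one degree_X _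
  obtain ⟨δ, hδ, -⟩ := exists_transport_avoiding hX
    (fun t => isNoncriticalValue_of_degree_one degree_X _) hS ha hb he
  exact ⟨δ, fun t => (hδ t).2⟩

end RatDecomp

end

noncomputable section

namespace RatDecomp

open Filter Topology Polynomial unitInterval

/-! ### Permutation equivalence and change of base point -/

theorem permEquivalent_of_forall {Ω Ω' : Type*} {G : Subgroup (Equiv.Perm Ω)}
    {G' : Subgroup (Equiv.Perm Ω')} (e : Ω ≃ Ω')
    (h : ∀ f ∈ G, ∃ g ∈ G', ∀ x, e (f x) = g (e x))
    (h' : ∀ g ∈ G', ∃ f ∈ G, ∀ x, e (f x) = g (e x)) : PermEquivalent G G' := by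
  have key : ∀ (f : Equiv.Perm Ω) (g : Equiv.Perm Ω'), (∀ x, e (f x) = g (e x)) →
      e.permCongrHom f = g := by
    intro f g hfg
    ext y
    change e (f (e.symm y)) = g y
    rw [hfg, e.apply_symm_apply]
  refine ⟨e, le_antisymm ?_ ?_⟩
  · rintro _ ⟨f, hf, rfl⟩
    obtain ⟨g, hg, hfg⟩ := h f hf
    have := key f g hfg
    exact this ▸ hg
  · intro g hg
    obtain ⟨f, hf, hfg⟩ := h' g hg
    exact ⟨f, hf, key f g hfg⟩

theorem PermEquivalent.exists_equiv {Ω Ω' : Type*} {G : Subgroup (Equiv.Perm Ω)}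
    {G' : Subgroup (Equiv.Perm Ω')} (h : PermEquivalent G G') :
    ∃ e : Ω ≃ Ω', (∀ f ∈ G, e.permCongrHom f ∈ G') ∧
      ∀ g ∈ G', ∃ f ∈ G, ∀ x, e (f x) = g (e x) := by
  obtain ⟨e, he⟩ := h
  refine ⟨e, fun f hf => he ▸ Subgroup.mem_map_of_mem _ hf, fun g hg => ?_⟩
  rw [← he] at hg
  obtain ⟨f, hf, rfl⟩ := hg
  refine ⟨f, hf, fun x => ?_⟩
  change _ = e (f (e.symm (e x)))
  rw [e.symm_apply_apply]

theorem permCongrHom_apply {Ω Ω' : Type*} (e : Ω ≃ Ω') (f : Equiv.Perm Ω) (x : Ω) :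
    e.permCongrHom f (e x) = e (f x) := by
  change e (f (e.symm (e x))) = _
  rw [e.symm_apply_apply]

theorem PermEquivalent.symm {Ω Ω' : Type*} {G : Subgroup (Equiv.Perm Ω)}
    {G' : Subgroup (Equiv.Perm Ω')} (h : PermEquivalent G G') : PermEquivalent G' G := by
  obtain ⟨e, h1, h2⟩ := h.exists_equiv
  refine permEquivalent_of_forall e.symm (fun g hg => ?_) fun f hf => ?_
  · obtain ⟨f, hf, hfg⟩ := h2 g hg
    refine ⟨f, hf, fun y => ?_⟩
    rw [Equiv.symm_apply_eq, hfg, e.apply_symm_apply]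
  · refine ⟨_, h1 f hf, fun y => ?_⟩
    rw [Equiv.symm_apply_eq, ← permCongrHom_apply, e.apply_symm_apply]

theorem PermEquivalent.trans {Ω Ω' Ω'' : Type*} {G : Subgroup (Equiv.Perm Ω)}
    {G' : Subgroup (Equiv.Perm Ω')} {G'' : Subgroup (Equiv.Perm Ω'')} (h : PermEquivalent G G')
    (h' : PermEquivalent G' G'') : PermEquivalent G G'' := by
  obtain ⟨e, h1, h2⟩ := h.exists_equiv
  obtain ⟨e', h1', h2'⟩ := h'.exists_equiv
  refine permEquivalent_of_forall (e.trans e') (fun f hf => ?_) fun g hg => ?_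
  · refine ⟨_, h1' _ (h1 f hf), fun x => ?_⟩
    rw [Equiv.trans_apply, Equiv.trans_apply, permCongrHom_apply, permCongrHom_apply]
  · obtain ⟨g', hg', hgg'⟩ := h2' g hg
    obtain ⟨f, hf, hfg⟩ := h2 g' hg'
    refine ⟨f, hf, fun x => ?_⟩
    rw [Equiv.trans_apply, Equiv.trans_apply, hfg, hgg']

/-- Conjugation by the transport along a path joining the base points. -/
theorem permEquivalent_monodromyGroup {F : RatFunc ℂ} (hF : degree F ≠ 0) {a b : OnePoint ℂ}
    (ha : IsNoncriticalValue F a) (hb : IsNoncriticalValue F b) :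
    PermEquivalent (monodromyGroup F a ha) (monodromyGroup F b hb) := by
  obtain ⟨γ, hγ'⟩ := exists_path_avoiding (finite_critical hF) (a := a) (b := b)
    (by simpa using ha) (by simpa using hb)
  have hγ : ∀ t, IsNoncriticalValue F (γ t) := by simpa using hγ'
  obtain ⟨e, he⟩ := exists_isTransport hF γ hγ
  have htrans : ∀ {a b c : OnePoint ℂ} {γ : Path a b} {δ : Path b c},
      (∀ t, IsNoncriticalValue F (γ t)) → (∀ t, IsNoncriticalValue F (δ t)) →
      ∀ t, IsNoncriticalValue F (γ.trans δ t) := by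
    intro a b c γ δ h1 h2 t
    rw [Path.trans_apply]
    split_ifs
    · exact h1 _
    · exact h2 _
  refine permEquivalent_of_forall e ?_ ?_
  · rintro f ⟨δ, hδ, hf⟩
    refine ⟨(e.symm.trans f).trans e, ⟨(γ.symm.trans δ).trans γ,
      htrans (htrans (fun t => hγ (σ t)) hδ) hγ, (he.symm.trans hf).trans he⟩, fun x => ?_⟩
    simp
  · rintro g ⟨δ, hδ, hg⟩
    refine ⟨(e.trans g).trans e.symm, ⟨(γ.trans δ).trans γ.symm,
      htrans (htrans hγ hδ) (fun t => hγ (σ t)), (he.trans hg).trans he.symm⟩, fun x => ?_⟩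
    simp

theorem sameMonodromy_of_permEquivalent {A B : RatFunc ℂ} (hA : degree A ≠ 0)
    (hB : degree B ≠ 0) {a b : OnePoint ℂ} (ha : IsNoncriticalValue A a)
    (hb : IsNoncriticalValue B b)
    (h : PermEquivalent (monodromyGroup A a ha) (monodromyGroup B b hb)) : SameMonodromy A B :=
  fun _ _ ha' hb' => ((permEquivalent_monodromyGroup hA ha' ha).trans h).trans
    (permEquivalent_monodromyGroup hB hb hb')

theorem sameMonodromy_refl {A : RatFunc ℂ} (hA : degree A ≠ 0) : SameMonodromy A A :=
  fun _ _ ha hb => permEquivalent_monodromyGroup hA ha hb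

theorem SameMonodromy.symm {A B : RatFunc ℂ} (h : SameMonodromy A B) : SameMonodromy B A :=
  fun b a hb ha => (h a b ha hb).symm

theorem SameMonodromy.trans {A B D : RatFunc ℂ} (hB : degree B ≠ 0) (h : SameMonodromy A B)
    (h' : SameMonodromy B D) : SameMonodromy A D := by
  intro a d ha hd
  obtain ⟨b, -, hb⟩ := exists_isNoncriticalValue hB Set.finite_empty
  exact (h a b ha hb).trans (h' b d hb hd)

/-! ### Transport and composition -/

theorem sphereMap_mem_fiber {A B : RatFunc ℂ} (hB : degree B ≠ 0) {w x : OnePoint ℂ}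
    (hx : x ∈ fiber (comp A B) w) : sphereMap B x ∈ fiber A w := by
  rw [mem_fiber, ← sphereMap_comp A hB]
  exact hx

theorem mem_fiber_comp {A B : RatFunc ℂ} (hB : degree B ≠ 0) {w x y : OnePoint ℂ}
    (hx : x ∈ fiber B y) (hy : y ∈ fiber A w) : x ∈ fiber (comp A B) w := by
  rw [mem_fiber, sphereMap_comp A hB, mem_fiber.1 hx]
  exact hy

/-- B carries a lift through A ∘ B to a lift through A. -/
theorem IsTransport.comp_left {A B : RatFunc ℂ} (hA : degree A ≠ 0) (hB : degree B ≠ 0)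
    {a b : OnePoint ℂ} {γ : Path a b} (hγ : ∀ t, IsNoncriticalValue (comp A B) (γ t))
    {e : fiber (comp A B) a ≃ fiber (comp A B) b} (he : IsTransport (comp A B) γ e)
    {f : fiber A a ≃ fiber A b} (hf : IsTransport A γ f) (x : fiber (comp A B) a) :
    sphereMap B (e x) = f ⟨sphereMap B x, sphereMap_mem_fiber hB x.2⟩ := by
  obtain ⟨Γ, hΓ⟩ := he x
  refine (hf.apply_eq hA (fun t => ((hγ t).of_comp hA hB).1)
    (x := ⟨sphereMap B x, sphereMap_mem_fiber hB x.2⟩)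
    (Γ := Γ.map (continuous_sphereMap B)) fun t => ?_).symm
  rw [← hΓ, sphereMap_comp A hB]
  rfl

theorem isNoncriticalValue_of_lift {A B : RatFunc ℂ} (hA : degree A ≠ 0) (hB : degree B ≠ 0)
    {w y : OnePoint ℂ} (hw : IsNoncriticalValue (comp A B) w) (hy : sphereMap A y = w) :
    IsNoncriticalValue B y := (hw.of_comp hA hB).2 y hy

/-- A lift of δ through B is a lift of γ = A ∘ δ through A ∘ B. -/
theorem IsTransport.comp_right {A B : RatFunc ℂ} (hA : degree A ≠ 0) (hB : degree B ≠ 0)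
    {a b : OnePoint ℂ} {γ : Path a b} (hγ : ∀ t, IsNoncriticalValue (comp A B) (γ t))
    {e : fiber (comp A B) a ≃ fiber (comp A B) b} (he : IsTransport (comp A B) γ e)
    {y z : OnePoint ℂ} (hy : y ∈ fiber A a) {δ : Path y z} (hδ : ∀ t, sphereMap A (δ t) = γ t)
    {d : fiber B y ≃ fiber B z} (hd : IsTransport B δ d) (x : fiber B y) :
    (d x : OnePoint ℂ) = e ⟨x, mem_fiber_comp hB x.2 hy⟩ := by
  obtain ⟨Δ, hΔ⟩ := hd x
  refine (he.apply_eq (degree_comp_ne_zero hA hB) hγ (x := ⟨x, mem_fiber_comp hB x.2 hy⟩)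
    (Γ := Δ) fun t => ?_).symm
  rw [sphereMap_comp A hB, hΔ, hδ]

/-- If `A' ∘ A = C' ∘ C`, and `A` maps a fiber of `C` bijectively onto a fiber of `A'`, then `C`
and `A'` have the same monodromy group, provided that any two points of the fiber with the same
image under `A` are related by an element of the monodromy group which does not change `A`. -/
theorem sameMonodromy_of_bijOn {A' A C' C : RatFunc ℂ} (hA' : degree A' ≠ 0) (hA : degree A ≠ 0)
    (hC' : degree C' ≠ 0) (hC : degree C ≠ 0) (hF : comp A' A = comp C' C) {w : OnePoint ℂ}
    (hw : IsNoncriticalValue (comp A' A) w) {y : OnePoint ℂ} (hy : y ∈ fiber C' w)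
    (hbij : Set.BijOn (sphereMap A) (fiber C y) (fiber A' w))
    (hmove : ∀ x x' : fiber (comp A' A) w, sphereMap A x = sphereMap A x' →
      ∃ k, IsMonodromyPerm (comp A' A) w k ∧ k x = x' ∧ ∀ v, sphereMap A (k v) = sphereMap A v) :
    SameMonodromy C A' := by
  have hFdeg : degree (comp A' A) ≠ 0 := degree_comp_ne_zero hA' hA
  have hyC : IsNoncriticalValue C y := ((hF ▸ hw).of_comp hC' hC).2 y hy
  have hwA' : IsNoncriticalValue A' w := (hw.of_comp hA' hA).1
  have hmem : ∀ x ∈ fiber C y, x ∈ fiber (comp A' A) w := fun x hx => by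
    rw [hF]
    exact mem_fiber_comp hC hx hy
  have hmapF : ∀ p, sphereMap (comp A' A) p = sphereMap C' (sphereMap C p) := fun p => by
    rw [hF, sphereMap_comp C' hC]
  let E : fiber C y ≃ fiber A' w := hbij.equiv _
  have hE : ∀ x : fiber C y, (E x : OnePoint ℂ) = sphereMap A x := fun x => rfl
  -- a loop at `w` whose lift by `C'` from `y` is closed acts compatibly on both fibers
  have hcompat : ∀ (γ : Path w w) (δ : Path y y) (d : Equiv.Perm (fiber C y))
      (e : Equiv.Perm (fiber (comp A' A) w)) (f : Equiv.Perm (fiber A' w)),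
      (∀ t, IsNoncriticalValue (comp A' A) (γ t)) → (∀ t, sphereMap C' (δ t) = γ t) →
      IsTransport C δ d → IsTransport (comp A' A) γ e →
      (∀ v : fiber (comp A' A) w, sphereMap A (e v) =
        f ⟨sphereMap A v, sphereMap_mem_fiber hA v.2⟩) →
      ∀ x, E (d x) = f (E x) := by
    intro γ δ d e f hγ hδ hd he hf x
    apply Subtype.ext
    have h1 : (d x : OnePoint ℂ) = e ⟨x, hmem x x.2⟩ := by
      obtain ⟨Δ, hΔ⟩ := hd x
      refine (he.apply_eq hFdeg hγ (x := ⟨x, hmem x x.2⟩) (Γ := Δ) fun t => ?_).symm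
      rw [hmapF, hΔ, hδ]
    rw [hE, h1, hf]
    rfl
  refine sameMonodromy_of_permEquivalent hC hA' hyC hwA' (permEquivalent_of_forall E ?_ ?_)
  · rintro d ⟨δ₀, hδ₀, hd₀⟩
    -- Once the loop at y avoids these points, its image under C' avoids the critical values of F,
    -- so it can be lifted through F.
    have hfin : (sphereMap C' ⁻¹' {u | ¬ IsNoncriticalValue (comp A' A) u}).Finite :=
      (finite_critical hFdeg).preimage' fun u _ => finite_fiber hC' u
    have hyS : y ∉ sphereMap C' ⁻¹' {u | ¬ IsNoncriticalValue (comp A' A) u} := by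
      rw [Set.mem_preimage, mem_fiber.1 hy]
      simpa using hw
    obtain ⟨δ, hδ, hd⟩ := exists_transport_avoiding hC hδ₀ hfin hyS hyS hd₀
    let γ : Path w w := (δ.map (continuous_sphereMap C')).cast hy.symm hy.symm
    have hγ : ∀ t, IsNoncriticalValue (comp A' A) (γ t) := fun t =>
      not_not.1 (hδ t).2
    obtain ⟨e, he⟩ := exists_isTransport hFdeg γ hγ
    have hγ' : ∀ t, IsNoncriticalValue A' (γ t) := fun t => ((hγ t).of_comp hA' hA).1
    obtain ⟨f, hf⟩ := exists_isTransport hA' γ hγ'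
    exact ⟨f, ⟨γ, hγ', hf⟩,
      hcompat γ δ d e f hγ (fun t => rfl) hd he fun v => he.comp_left hA' hA hγ hf v⟩
  · rintro f ⟨γ₀, hγ₀, hf₀⟩
    have hwS : w ∉ {u | ¬ IsNoncriticalValue (comp A' A) u} := by simpa using hw
    obtain ⟨γ, hγ', hf⟩ := exists_transport_avoiding hA' hγ₀ (finite_critical hFdeg) hwS hwS hf₀
    have hγ : ∀ t, IsNoncriticalValue (comp A' A) (γ t) := fun t => by
      simpa using (hγ' t).2
    obtain ⟨e, he⟩ := exists_isTransport hFdeg γ hγ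
    obtain ⟨x₀, hx₀⟩ := surjective_sphereMap hC y
    let x : fiber (comp A' A) w := ⟨x₀, hmem x₀ hx₀⟩
    -- The lift of γ from x may end outside the fibre of C over y. Its endpoint has the same image
    -- under A as some x' in that fibre, and k moves it there without affecting A. The lift of γ
    -- followed by κ then projects under C to a closed loop at y.
    obtain ⟨x', hx'y, hx'⟩ := hbij.surjOn (sphereMap_mem_fiber hA (e x).2)
    obtain ⟨k, ⟨κ, hκ, hk⟩, hkx, hkA⟩ := hmove (e x) ⟨x', hmem x' hx'y⟩ hx'.symm
    have hγκ : ∀ t, IsNoncriticalValue (comp A' A) (γ.trans κ t) := by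
      intro t
      rw [Path.trans_apply]
      split_ifs
      · exact hγ _
      · exact hκ _
    have hek : IsTransport (comp A' A) (γ.trans κ) (e.trans k) := he.trans hk
    obtain ⟨Γ, hΓ⟩ := hek x
    have hend : ((e.trans k) x : OnePoint ℂ) = x' := by
      rw [Equiv.trans_apply, hkx]
    let δ : Path y y := (Γ.map (continuous_sphereMap C)).cast hx₀.symm (by
      rw [hend]; exact (mem_fiber.1 hx'y).symm)
    have hδ : ∀ t, sphereMap C' (δ t) = γ.trans κ t := fun t => by
      rw [← hΓ, hmapF]
      rfl
    have hδN : ∀ t, IsNoncriticalValue C (δ t) := fun t =>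
      isNoncriticalValue_of_lift hC' hC (hF ▸ hγκ t) (hδ t)
    obtain ⟨d, hd⟩ := exists_isTransport hC δ hδN
    refine ⟨d, ⟨δ, hδN, hd⟩, hcompat _ δ d _ f hγκ hδ hd hek fun v => ?_⟩
    rw [Equiv.trans_apply, hkA]
    exact he.comp_left hA' hA hγ hf v

theorem bijective_sphereMap_of_degree_one {μ : RatFunc ℂ} (hμ : degree μ = 1) :
    Function.Bijective (sphereMap μ) := by
  have h0 : degree μ ≠ 0 := by omega
  refine ⟨fun x y hxy => ?_, surjective_sphereMap h0⟩
  have h := (isNoncriticalValue_of_degree_one hμ (sphereMap μ y))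
  rw [IsNoncriticalValue, hμ, Nat.cast_one, Set.encard_eq_one] at h
  obtain ⟨u, hu⟩ := h
  have hx : x ∈ fiber μ (sphereMap μ y) := hxy
  have hy : y ∈ fiber μ (sphereMap μ y) := rfl
  rw [hu] at hx hy
  exact hx.trans hy.symm

theorem isMonodromyPerm_one {F : RatFunc ℂ} {w : OnePoint ℂ} (hw : IsNoncriticalValue F w) :
    IsMonodromyPerm F w 1 := (monodromyGroup F w hw).one_mem

/-- Here μ itself maps the fibre of A ∘ μ bijectively onto that of A, so `sameMonodromy_of_bijOn`
applies with C' the identity. -/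
theorem sameMonodromy_comp_degree_one {A μ : RatFunc ℂ} (hA : degree A ≠ 0) (hμ : degree μ = 1) :
    SameMonodromy (comp A μ) A := by
  have h0 : degree μ ≠ 0 := by omega
  have hX : degree RatFunc.X ≠ 0 := by simp [degree_X]
  have hd := degree_comp_ne_zero hA h0
  obtain ⟨w, -, hw⟩ := exists_isNoncriticalValue hd Set.finite_empty
  have hb := bijective_sphereMap_of_degree_one hμ
  refine sameMonodromy_of_bijOn (A' := A) (A := μ) (C' := RatFunc.X) (C := comp A μ) hA h0 hX hd
    (X_comp _).symm hw (y := w) (sphereMap_X w) ⟨fun x hx => sphereMap_mem_fiber h0 hx,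
      hb.1.injOn, fun u hu => ?_⟩ fun x x' h => ⟨1, isMonodromyPerm_one hw, ?_, fun _ => rfl⟩
  · obtain ⟨x, rfl⟩ := hb.2 u
    exact ⟨x, by rw [mem_fiber, sphereMap_comp A h0]; exact hu, rfl⟩
  · exact Subtype.ext (hb.1 h)

/-- The fibres over y and μ(y) coincide, so `sameMonodromy_of_bijOn` applies with the identity as
the map between them. -/
theorem sameMonodromy_degree_one_comp {A μ : RatFunc ℂ} (hA : degree A ≠ 0) (hμ : degree μ = 1) :
    SameMonodromy A (comp μ A) := by
  have h0 : degree μ ≠ 0 := by omega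
  have hX : degree RatFunc.X ≠ 0 := by simp [degree_X]
  have hd := degree_comp_ne_zero h0 hA
  obtain ⟨w, -, hw⟩ := exists_isNoncriticalValue hd Set.finite_empty
  have hb := bijective_sphereMap_of_degree_one hμ
  obtain ⟨y, rfl⟩ := hb.2 w
  rw [← comp_X (comp μ A)] at hw
  refine sameMonodromy_of_bijOn (A' := comp μ A) (A := RatFunc.X) (C' := μ) (C := A) hd hX h0 hA
    (comp_X _) hw (y := y) rfl ⟨fun x hx => ?_, fun x _ x' _ h => ?_, fun u hu => ?_⟩
    fun x x' h => ⟨1, isMonodromyPerm_one hw, ?_, fun _ => rfl⟩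
  · rw [sphereMap_X, mem_fiber, sphereMap_comp μ hA, mem_fiber.1 hx]
  · rwa [sphereMap_X, sphereMap_X] at h
  · rw [mem_fiber, sphereMap_comp μ hA] at hu
    exact ⟨u, hb.1 hu, sphereMap_X u⟩
  · rw [sphereMap_X, sphereMap_X] at h
    exact Subtype.ext h

end RatDecomp

end

noncomputable section

namespace RatDecomp

open Filter Topology Polynomial unitInterval

/-! ### Transitive Hamiltonian groups of monodromy permutations -/

/-- A Hamiltonian group acts transitively on the fiber of `F` over `w` by monodromy
permutations. -/
def HasHamiltonianAction (F : RatFunc ℂ) (w : OnePoint ℂ) : Prop :=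
  ∃ (Γ : Type) (_ : Group Γ) (ρ : Γ →* Equiv.Perm (fiber F w)),
    (∀ g, IsMonodromyPerm F w (ρ g)) ∧ (∀ x y, ∃ g, ρ g x = y) ∧ IsHamiltonian Γ

theorem IsHamiltonian.subgroup {Γ : Type*} [Group Γ] (h : IsHamiltonian Γ) (H : Subgroup Γ) :
    IsHamiltonian H := by
  intro L
  have hn := h (L.map H.subtype)
  refine ⟨fun n hnL g => ?_⟩
  have := hn.conj_mem n ⟨n, hnL, rfl⟩ g
  obtain ⟨m, hm, hmn⟩ := this
  have hmg : m = g * n * g⁻¹ := Subtype.ext hmn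
  rwa [← hmg]

theorem HasHamiltonianAction.of_base {F : RatFunc ℂ} (hF : degree F ≠ 0) {a b : OnePoint ℂ}
    (ha : IsNoncriticalValue F a) (hb : IsNoncriticalValue F b) (h : HasHamiltonianAction F a) :
    HasHamiltonianAction F b := by
  obtain ⟨Γ, _, ρ, h1, h2, h3⟩ := h
  obtain ⟨e, he, -⟩ := (permEquivalent_monodromyGroup hF ha hb).exists_equiv
  refine ⟨Γ, _, (e.permCongrHom : Equiv.Perm (fiber F a) →* Equiv.Perm (fiber F b)).comp ρ,
    fun g => he _ (h1 g), fun x y => ?_, h3⟩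
  obtain ⟨g, hg⟩ := h2 (e.symm x) (e.symm y)
  refine ⟨g, ?_⟩
  have := permCongrHom_apply e (ρ g) (e.symm x)
  rw [e.apply_symm_apply, hg, e.apply_symm_apply] at this
  exact this

theorem IsMonodromyPerm.exists_left {A B : RatFunc ℂ} (hA : degree A ≠ 0) (hB : degree B ≠ 0)
    {w : OnePoint ℂ} {e : Equiv.Perm (fiber (comp A B) w)}
    (he : IsMonodromyPerm (comp A B) w e) :
    ∃ f : Equiv.Perm (fiber A w), IsMonodromyPerm A w f ∧ ∀ x,
      sphereMap B (e x) = f ⟨sphereMap B x, sphereMap_mem_fiber hB x.2⟩ := by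
  obtain ⟨γ, hγ, he⟩ := he
  have hγ' := fun t => ((hγ t).of_comp hA hB).1
  obtain ⟨f, hf⟩ := exists_isTransport hA γ hγ'
  exact ⟨f, ⟨γ, hγ', hf⟩, IsTransport.comp_left hA hB hγ he hf⟩

/-- Since `x₀` returns to the block over y, the image under B of its lift is a closed loop at y.
Lifting that loop through B gives the restriction of e to the block. -/
theorem IsMonodromyPerm.exists_right {A B : RatFunc ℂ} (hA : degree A ≠ 0) (hB : degree B ≠ 0)
    {w : OnePoint ℂ} {e : Equiv.Perm (fiber (comp A B) w)}
    (he : IsMonodromyPerm (comp A B) w e) {y : OnePoint ℂ} (hy : y ∈ fiber A w)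
    {x₀ : fiber (comp A B) w} (hx₀ : sphereMap B x₀ = y) (hex₀ : sphereMap B (e x₀) = y) :
    ∃ d : Equiv.Perm (fiber B y), IsMonodromyPerm B y d ∧ ∀ x : fiber B y,
      (d x : OnePoint ℂ) = e ⟨x, mem_fiber_comp hB x.2 hy⟩ := by
  obtain ⟨γ, hγ, he⟩ := he
  obtain ⟨Γ, hΓ⟩ := he x₀
  let δ : Path y y := (Γ.map (continuous_sphereMap B)).cast hx₀.symm hex₀.symm
  have hδ : ∀ t, sphereMap A (δ t) = γ t := fun t => by
    rw [← hΓ, sphereMap_comp A hB]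
    rfl
  have hδN : ∀ t, IsNoncriticalValue B (δ t) := fun t =>
    isNoncriticalValue_of_lift hA hB (hγ t) (hδ t)
  obtain ⟨d, hd⟩ := exists_isTransport hB δ hδN
  exact ⟨d, ⟨δ, hδN, hd⟩, IsTransport.comp_right hA hB hγ he hy hδ hd⟩

/-- The same abstract group acts on the set of blocks, so nothing about quotients of Hamiltonian
groups is required. -/
theorem HasHamiltonianAction.left {A B : RatFunc ℂ} (hA : degree A ≠ 0) (hB : degree B ≠ 0)
    {w : OnePoint ℂ} (h : HasHamiltonianAction (comp A B) w) : HasHamiltonianAction A w := by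
  obtain ⟨Γ, _, ρ, h1, h2, h3⟩ := h
  choose f hf hfB using fun g => (h1 g).exists_left hA hB
  have hsurj : ∀ y : fiber A w, ∃ x : fiber (comp A B) w,
      (⟨sphereMap B x, sphereMap_mem_fiber hB x.2⟩ : fiber A w) = y := by
    intro y
    obtain ⟨x, hx⟩ := surjective_sphereMap hB y
    exact ⟨⟨x, mem_fiber_comp hB hx y.2⟩, Subtype.ext hx⟩
  refine ⟨Γ, _, MonoidHom.mk' f fun g g' => ?_, hf, fun y y' => ?_, h3⟩
  · ext y
    obtain ⟨x, rfl⟩ := hsurj y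
    have e1 := hfB (g * g') x
    have e2 := hfB g (ρ g' x)
    rw [← e1, map_mul, Equiv.Perm.mul_apply, e2, Equiv.Perm.mul_apply]
    congr 2
    exact Subtype.ext (hfB g' x)
  · obtain ⟨x, rfl⟩ := hsurj y
    obtain ⟨x', rfl⟩ := hsurj y'
    obtain ⟨g, hg⟩ := h2 x x'
    refine ⟨g, Subtype.ext ?_⟩
    rw [MonoidHom.mk'_apply, ← hfB, hg]

theorem sphereMap_eq_iff_of_isMonodromyPerm {A B : RatFunc ℂ} (hA : degree A ≠ 0)
    (hB : degree B ≠ 0) {w : OnePoint ℂ} {e : Equiv.Perm (fiber (comp A B) w)}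
    (he : IsMonodromyPerm (comp A B) w e) (x y : fiber (comp A B) w) :
    sphereMap B (e x) = sphereMap B (e y) ↔ sphereMap B x = sphereMap B y := by
  obtain ⟨f, -, hf⟩ := he.exists_left hA hB
  rw [hf, hf, Subtype.coe_inj, f.apply_eq_iff_eq, Subtype.mk.injEq]

/-- The stabiliser H of the block over y acts on this block. It is transitive there because any
element sending one point of the block to another stabilises it. -/
theorem HasHamiltonianAction.right {A B : RatFunc ℂ} (hA : degree A ≠ 0) (hB : degree B ≠ 0)
    {w : OnePoint ℂ} (h : HasHamiltonianAction (comp A B) w) {y : OnePoint ℂ}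
    (hy : y ∈ fiber A w) : HasHamiltonianAction B y := by
  obtain ⟨Γ, _, ρ, h1, h2, h3⟩ := h
  obtain ⟨p, hp⟩ := surjective_sphereMap hB y
  let x₀ : fiber (comp A B) w := ⟨p, mem_fiber_comp hB hp hy⟩
  have hinv : ∀ g (x x' : fiber (comp A B) w),
      sphereMap B (ρ g x) = sphereMap B (ρ g x') ↔ sphereMap B x = sphereMap B x' :=
    fun g => sphereMap_eq_iff_of_isMonodromyPerm hA hB (h1 g)
  let H : Subgroup Γ :=
    { carrier := {g | sphereMap B (ρ g x₀) = y}
      one_mem' := by simpa using hp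
      mul_mem' := by
        intro g g' hg hg'
        rw [Set.mem_ofPred_eq, map_mul, Equiv.Perm.mul_apply]
        exact ((hinv g _ x₀).2 (hg'.trans hp.symm)).trans hg
      inv_mem' := by
        intro g hg
        rw [Set.mem_ofPred_eq, ← hp]
        refine (hinv g (ρ g⁻¹ x₀) x₀).1 ?_
        rw [← Equiv.Perm.mul_apply, ← map_mul, mul_inv_cancel, map_one]
        exact hp.trans (Eq.symm hg) }
  choose d hd hdx using fun g : H => (h1 g).exists_right hA hB hy (x₀ := x₀) hp g.2
  refine ⟨H, inferInstance, MonoidHom.mk' d fun g g' => ?_, hd, fun x x' => ?_, h3.subgroup H⟩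
  · ext x
    rw [hdx, Equiv.Perm.mul_apply, hdx, Subgroup.coe_mul, map_mul, Equiv.Perm.mul_apply]
    congr 2
    exact Subtype.ext (hdx g' x).symm
  · obtain ⟨g, hg⟩ := h2 ⟨x, mem_fiber_comp hB x.2 hy⟩ ⟨x', mem_fiber_comp hB x'.2 hy⟩
    have hgH : g ∈ H := by
      have := (hinv g x₀ ⟨x, mem_fiber_comp hB x.2 hy⟩).2 (hp.trans (mem_fiber.1 x.2).symm)
      rw [hg] at this
      exact this.trans x'.2
    refine ⟨⟨g, hgH⟩, Subtype.ext ?_⟩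
    rw [MonoidHom.mk'_apply, hdx, hg]

/-- In a Hamiltonian group acting transitively, the elements preserving one block of an invariant
partition preserve all its blocks. -/
theorem forall_eq_of_isHamiltonian {Γ Ω β : Type*} [Group Γ] (hΓ : IsHamiltonian Γ)
    (ρ : Γ →* Equiv.Perm Ω) (htrans : ∀ x y, ∃ g, ρ g x = y) {r : Ω → β}
    (hr : ∀ g x y, r (ρ g x) = r (ρ g y) ↔ r x = r y) {g : Γ} {x : Ω} (hg : r (ρ g x) = r x)
    (v : Ω) : r (ρ g v) = r v := by
  let H : Subgroup Γ :=
    { carrier := {g | r (ρ g x) = r x}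
      one_mem' := by simp
      mul_mem' := by
        intro g g' hg hg'
        rw [Set.mem_ofPred_eq, map_mul, Equiv.Perm.mul_apply]
        exact ((hr g _ x).2 hg').trans hg
      inv_mem' := by
        intro g hg
        rw [Set.mem_ofPred_eq, ← hr g, ← Equiv.Perm.mul_apply, ← map_mul, mul_inv_cancel,
          map_one]
        exact Eq.symm hg }
  obtain ⟨k, rfl⟩ := htrans x v
  -- By normality of H the conjugate of g stabilises the block of x, so g stabilises the block of k
  -- x = v.
  have hconj : k⁻¹ * g * k⁻¹⁻¹ ∈ H := (hΓ H).conj_mem g hg k⁻¹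
  have h2 : r (ρ (k⁻¹ * g * k) x) = r x := by
    have : r (ρ (k⁻¹ * g * k⁻¹⁻¹) x) = r x := hconj
    rwa [inv_inv] at this
  rw [← hr k, ← Equiv.Perm.mul_apply, ← map_mul] at h2
  rwa [show k * (k⁻¹ * g * k) = g * k by group, map_mul, Equiv.Perm.mul_apply] at h2

theorem HasHamiltonianAction.exists_move {F A' A : RatFunc ℂ} (hF : F = comp A' A)
    (hA' : degree A' ≠ 0) (hA : degree A ≠ 0) {w : OnePoint ℂ} (h : HasHamiltonianAction F w)
    (x x' : fiber F w) (hx : sphereMap A x = sphereMap A x') :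
    ∃ k, IsMonodromyPerm F w k ∧ k x = x' ∧ ∀ v, sphereMap A (k v) = sphereMap A v := by
  subst hF
  obtain ⟨Γ, _, ρ, h1, h2, h3⟩ := h
  obtain ⟨g, hg⟩ := h2 x x'
  refine ⟨ρ g, h1 g, hg, forall_eq_of_isHamiltonian h3 ρ h2
    (r := fun v : fiber (comp A' A) w => sphereMap A v) (x := x)
    (fun g => sphereMap_eq_iff_of_isMonodromyPerm hA' hA (h1 g)) ?_⟩
  rw [hg, hx]

/-- The partitions of a fiber defined by two right factors permute. -/
theorem HasHamiltonianAction.exists_permute {F A' A C' C : RatFunc ℂ} (hFA : F = comp A' A)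
    (hFC : F = comp C' C) (hA' : degree A' ≠ 0) (hA : degree A ≠ 0) (hC' : degree C' ≠ 0)
    (hC : degree C ≠ 0) {w : OnePoint ℂ} (h : HasHamiltonianAction F w) {x y z : OnePoint ℂ}
    (hx : x ∈ fiber F w) (hxy : sphereMap A x = sphereMap A y)
    (hyz : sphereMap C y = sphereMap C z) :
    ∃ y' ∈ fiber F w, sphereMap C x = sphereMap C y' ∧ sphereMap A y' = sphereMap A z := by
  have hy : y ∈ fiber F w := by
    rw [mem_fiber, hFA, sphereMap_comp A' hA, ← hxy, ← sphereMap_comp A' hA, ← hFA]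
    exact hx
  have hz : z ∈ fiber F w := by
    rw [mem_fiber, hFC, sphereMap_comp C' hC, ← hyz, ← sphereMap_comp C' hC, ← hFC]
    exact hy
  -- The witness is y' = k x: k preserves every block of C, and it sends x and y, which A
  -- identifies, to points that A identifies, while k y = z.
  obtain ⟨k, hk, hky, hkC⟩ := h.exists_move hFC hC' hC ⟨y, hy⟩ ⟨z, hz⟩ hyz
  refine ⟨k ⟨x, hx⟩, (k ⟨x, hx⟩).2, (hkC ⟨x, hx⟩).symm, ?_⟩
  subst hFA
  have := (sphereMap_eq_iff_of_isMonodromyPerm hA' hA hk ⟨x, hx⟩ ⟨y, hy⟩).2 hxy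
  rw [this, hky]

end RatDecomp

end

noncomputable section

namespace RatDecomp

open Filter Topology Polynomial IntermediateField

/-! ### Subfields of the field of rational functions -/

theorem transcendental_of_degree_ne_zero {B : RatFunc ℂ} (hB : degree B ≠ 0) :
    Transcendental ℂ B :=
  B.transcendental_of_ne_C fun h => hB (degree_eq_zero_iff.2 h)

/-- As B is transcendental, substitution of B is an isomorphism from ℂ(z) onto ℂ(B). -/
theorem mem_adjoin_iff {B : RatFunc ℂ} (hB : degree B ≠ 0) {f : RatFunc ℂ} :
    f ∈ ℂ⟮B⟯ ↔ ∃ A, f = comp A B := by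
  let e := RatFunc.algEquivOfTranscendental B (transcendental_of_degree_ne_zero hB)
  have he : ∀ u, (e u : RatFunc ℂ) = comp u B := fun u => by
    rw [comp_eq, RatFunc.algEquivOfTranscendental_apply, div_eq_mul_inv]
  constructor
  · intro hf
    refine ⟨e.symm ⟨f, hf⟩, ?_⟩
    rw [← he, e.apply_symm_apply]
  · rintro ⟨A, rfl⟩
    rw [← he]
    exact (e A).2

/-- Precomposition with a nonconstant rational function, as a field homomorphism. -/
def compHom {B : RatFunc ℂ} (hB : degree B ≠ 0) : RatFunc ℂ →ₐ[ℂ] RatFunc ℂ :=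
  ℂ⟮B⟯.val.comp
    (RatFunc.algEquivOfTranscendental B (transcendental_of_degree_ne_zero hB)).toAlgHom

theorem compHom_apply {B : RatFunc ℂ} (hB : degree B ≠ 0) (u : RatFunc ℂ) :
    compHom hB u = comp u B := by
  rw [comp_eq, ← div_eq_mul_inv]
  exact RatFunc.algEquivOfTranscendental_apply _ _ _

theorem finrank_adjoin (F : RatFunc ℂ) : Module.finrank ℂ⟮F⟯ (RatFunc ℂ) = degree F :=
  F.finrank_eq_max_natDegree

/-- Lüroth's theorem; the generator is nonconstant because the field contains f. -/
theorem exists_eq_adjoin {E : IntermediateField ℂ (RatFunc ℂ)} {f : RatFunc ℂ} (hf : f ∈ E)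
    (hdeg : degree f ≠ 0) : ∃ p, degree p ≠ 0 ∧ E = ℂ⟮p⟯ := by
  refine ⟨RatFunc.Luroth.generator E, fun h => ?_, RatFunc.Luroth.eq_adjoin_generator⟩
  obtain ⟨c, hc⟩ := degree_eq_zero_iff.1 h
  refine RatFunc.Luroth.generator_ne_C (E := E) (fun hE => ?_) ⟨c, hc⟩
  rw [hE, IntermediateField.mem_bot] at hf
  obtain ⟨c, rfl⟩ := hf
  exact hdeg (degree_C c)

/-- The index [ℂ(z) : ℂ(μ)] is the degree of μ, so z is a rational function of μ. -/
theorem exists_inverse_of_degree_one {μ : RatFunc ℂ} (hμ : degree μ = 1) :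
    ∃ ν, degree ν = 1 ∧ comp ν μ = RatFunc.X ∧ comp μ ν = RatFunc.X := by
  have h0 : degree μ ≠ 0 := by omega
  have htop : ℂ⟮μ⟯ = ⊤ := by
    rw [← IntermediateField.finrank_eq_one_iff_eq_top, finrank_adjoin, hμ]
  have hX : RatFunc.X ∈ ℂ⟮μ⟯ := htop ▸ IntermediateField.mem_top
  obtain ⟨ν, hν⟩ := (mem_adjoin_iff h0).1 hX
  have hν0 : degree ν ≠ 0 := (degree_ne_zero_of_comp (by rw [← hν, degree_X]; exact one_ne_zero)).1
  have hdeg := degree_comp hν0 h0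
  rw [← hν, degree_X, hμ, mul_one] at hdeg
  refine ⟨ν, hdeg.symm, hν.symm, comp_right_cancel h0 ?_⟩
  rw [comp_assoc _ _ h0, ← hν, comp_X, X_comp]

theorem adjoin_eq_of_comp {μ B : RatFunc ℂ} (hμ : degree μ = 1) (hB : degree B ≠ 0) :
    ℂ⟮comp μ B⟯ = ℂ⟮B⟯ := by
  have hμ0 : degree μ ≠ 0 := by omega
  obtain ⟨ν, -, hν, -⟩ := exists_inverse_of_degree_one hμ
  apply le_antisymm
  · rw [adjoin_simple_le_iff]
    exact (mem_adjoin_iff hB).2 ⟨μ, rfl⟩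
  · rw [adjoin_simple_le_iff]
    refine (mem_adjoin_iff (degree_comp_ne_zero hμ0 hB)).2 ⟨ν, ?_⟩
    rw [← comp_assoc _ _ hB, hν, X_comp]

/-! ### Rational functions constant along fibers -/

/-- Finitely many bad points have finitely many images, so "for general x" becomes "for all x over a
general value". -/
theorem eventually_forall_fiber {α β : Type*} {f : α → β} {P : α → Prop}
    (h : ∀ᶠ x in cofinite, P x) : ∀ᶠ w in cofinite, ∀ x, f x = w → P x := by
  rw [eventually_cofinite] at h ⊢
  refine (h.image f).subset fun w hw => ?_
  simp only [Set.mem_ofPred_eq, not_forall] at hw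
  obtain ⟨x, hx, hP⟩ := hw
  exact ⟨x, hP, hx⟩

theorem eventually_forall_sphereMap (F : RatFunc ℂ) {P : ℂ → Prop}
    (h : ∀ᶠ x in cofinite, P x) :
    ∀ᶠ w in cofinite, ∀ x : ℂ, sphereMap F x = w → P x :=
  eventually_forall_fiber (f := fun x : ℂ => sphereMap F x) h

theorem tendsto_sphereMap {F : RatFunc ℂ} (hF : degree F ≠ 0) :
    Tendsto (sphereMap F) cofinite cofinite :=
  Tendsto.cofinite_of_finite_preimage_singleton fun w => finite_fiber hF w

/-- The rational function `g` takes the same value at any two points of a general fiber of `F`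
which are related by `R`. -/
def AgreesOn (F : RatFunc ℂ) (R : ℂ → ℂ → Prop) (g : RatFunc ℂ) : Prop :=
  ∀ᶠ w in cofinite, ∀ x y : ℂ, sphereMap F x = w → sphereMap F y = w → R x y → val g x = val g y

/-- The functions with this property form a field, each operation costing only finitely many values
of F. -/
theorem AgreesOn.of_mem_adjoin {F : RatFunc ℂ} {R : ℂ → ℂ → Prop} {S : Set (RatFunc ℂ)}
    (hS : ∀ g ∈ S, AgreesOn F R g) {g : RatFunc ℂ} (hg : g ∈ adjoin ℂ S) : AgreesOn F R g := by
  induction hg using IntermediateField.adjoin_induction with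
  | mem g hg => exact hS g hg
  | algebraMap c =>
    refine Eventually.of_forall fun w x y _ _ _ => ?_
    exact (val_C c x).trans (val_C c y).symm
  | add f g _ _ hf hg =>
    filter_upwards [hf, hg, eventually_forall_sphereMap F (eventually_val_add f g)]
      with w h1 h2 h3 x y hx hy hR
    rw [h3 x hx, h3 y hy, h1 x y hx hy hR, h2 x y hx hy hR]
  | inv f _ hf =>
    filter_upwards [hf, eventually_forall_sphereMap F (eventually_val_inv f)]
      with w h1 h3 x y hx hy hR
    rw [h3 x hx, h3 y hy, h1 x y hx hy hR]
  | mul f g _ _ hf hg =>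
    filter_upwards [hf, hg, eventually_forall_sphereMap F (eventually_val_mul f g)]
      with w h1 h2 h3 x y hx hy hR
    rw [h3 x hx, h3 y hy, h1 x y hx hy hR, h2 x y hx hy hR]

theorem agreesOn_of_sphereMap_eq {F : RatFunc ℂ} {R : ℂ → ℂ → Prop} {g : RatFunc ℂ}
    (h : ∀ x y : ℂ, sphereMap F x = sphereMap F y → R x y → sphereMap g x = sphereMap g y) :
    AgreesOn F R g := by
  filter_upwards [eventually_forall_sphereMap F (eventually_sphereMap_eq_val g)]
    with w h1 x y hx hy hR
  rw [← OnePoint.coe_eq_coe, ← h1 x hx, ← h1 y hy]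
  exact h x y (hx.trans hy.symm) hR

theorem eventually_coe_of_mem_fiber (F : RatFunc ℂ) :
    ∀ᶠ w in cofinite, ∀ p ∈ fiber F w, ∃ z : ℂ, (z : OnePoint ℂ) = p := by
  have h : ∀ᶠ w in cofinite, w ≠ sphereMap F ∞ := by
    rw [eventually_cofinite]
    simp
  filter_upwards [h] with w hw p hp
  rw [← OnePoint.ne_infty_iff_exists]
  rintro rfl
  exact hw hp.symm

theorem eventually_isNoncriticalValue {F : RatFunc ℂ} (hF : degree F ≠ 0) :
    ∀ᶠ w in cofinite, IsNoncriticalValue F w := by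
  rw [eventually_cofinite]
  exact finite_critical hF

/-- A rational function which is constant on general fibers of `B` is a function of `B`. -/
theorem mem_adjoin_of_agreesOn {B f : RatFunc ℂ} (hB : degree B ≠ 0)
    (hf : AgreesOn B (fun _ _ => True) f) : f ∈ ℂ⟮B⟯ := by
  have hBmem : B ∈ adjoin ℂ {B, f} := subset_adjoin _ _ (by simp)
  have hfmem : f ∈ adjoin ℂ {B, f} := subset_adjoin _ _ (by simp)
  -- With ℂ(B, f) = ℂ(p) and B = Q ∘ p, the function p is constant on general fibres of B. Hence
  -- general fibres of Q are single points, deg Q = 1 and ℂ(B) = ℂ(p).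
  obtain ⟨p, hp, hE⟩ := exists_eq_adjoin hBmem hB
  have hpagree : AgreesOn B (fun _ _ => True) p := by
    refine AgreesOn.of_mem_adjoin (S := {B, f}) ?_ (hE ▸ mem_adjoin_simple_self ℂ p)
    rintro g (rfl | rfl)
    · exact agreesOn_of_sphereMap_eq fun x y h _ => h
    · exact hf
  obtain ⟨Q, hQ⟩ := (mem_adjoin_iff hp).1 (hE ▸ hBmem)
  have hQ0 : degree Q ≠ 0 := (degree_ne_zero_of_comp (hQ ▸ hB)).1
  obtain ⟨w, h1, h2, h3, h4⟩ := (hpagree.and ((eventually_coe_of_mem_fiber B).and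
    ((eventually_isNoncriticalValue hQ0).and
      (eventually_forall_sphereMap B (eventually_sphereMap_eq_val p))))).exists
  have hsub : (fiber Q w).Subsingleton := by
    have hlift : ∀ y ∈ fiber Q w, ∃ x : ℂ, sphereMap B x = w ∧ sphereMap p x = y := by
      intro y hy
      obtain ⟨q, rfl⟩ := surjective_sphereMap hp y
      have hq : q ∈ fiber B w := by
        rw [mem_fiber, hQ, sphereMap_comp Q hp]
        exact hy
      obtain ⟨x, rfl⟩ := h2 q hq
      exact ⟨x, hq, rfl⟩
    intro y hy y' hy'
    obtain ⟨x, hx, rfl⟩ := hlift y hy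
    obtain ⟨x', hx', rfl⟩ := hlift y' hy'
    rw [h4 x hx, h4 x' hx', h1 x x' hx hx' trivial]
  have hQ1 : degree Q = 1 := by
    have hle := Set.encard_le_one_iff_subsingleton.2 hsub
    rw [h3] at hle
    have : degree Q ≤ 1 := by exact_mod_cast hle
    omega
  rw [hQ, adjoin_eq_of_comp hQ1 hp, ← hE]
  exact hfmem

/-! ### Linear disjointness of right factors -/

theorem eventually_val_sum {ι : Type*} (s : Finset ι) (f : ι → RatFunc ℂ) :
    ∀ᶠ z in cofinite, val (∑ i ∈ s, f i) z = ∑ i ∈ s, val (f i) z := by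
  classical
  induction s using Finset.induction_on with
  | empty => exact Eventually.of_forall fun z => by simp [val]
  | insert a s ha ih =>
    filter_upwards [ih, eventually_val_add (f a) (∑ i ∈ s, f i)] with z h1 h2
    rw [Finset.sum_insert ha, Finset.sum_insert ha, h2, h1]

theorem eventually_val_pow (f : RatFunc ℂ) (n : ℕ) :
    ∀ᶠ z in cofinite, val (f ^ n) z = val f z ^ n := by
  filter_upwards [eventually_val_aeval f (X ^ n)] with z hz
  simpa using hz

/-- The minimal polynomial of A over ℂ(C). Its degree is [ℂ(z) : ℂ(C)] = deg C because A generates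
ℂ(z) over ℂ(C). -/
theorem exists_monic_relation {A C : RatFunc ℂ} (hC : degree C ≠ 0)
    (hgen : adjoin ℂ {A, C} = ⊤) :
    ∃ b : ℕ → RatFunc ℂ, (∀ i, b i ∈ ℂ⟮C⟯) ∧
      A ^ degree C + ∑ i ∈ Finset.range (degree C), b i * A ^ i = 0 := by
  have hfin : FiniteDimensional ℂ⟮C⟯ (RatFunc ℂ) :=
    Module.finite_of_finrank_pos (by rw [finrank_adjoin]; omega)
  have hint : IsIntegral ℂ⟮C⟯ A := Algebra.IsIntegral.isIntegral A
  have htop : ℂ⟮C⟯⟮A⟯ = ⊤ := by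
    rw [← restrictScalars_eq_top_iff (K := ℂ), adjoin_adjoin_left, ← hgen]
    congr 1
    ext f
    simp
  have hdeg : (minpoly ℂ⟮C⟯ A).natDegree = degree C := by
    rw [← adjoin.finrank hint, htop, finrank_top', finrank_adjoin]
  refine ⟨fun i => ((minpoly ℂ⟮C⟯ A).coeff i : RatFunc ℂ), fun i => SetLike.coe_mem _, ?_⟩
  have h := minpoly.aeval ℂ⟮C⟯ A
  rw [aeval_eq_sum_range, Finset.sum_range_succ, coeff_natDegree, (minpoly.monic hint).leadingCoeff,
    one_smul, hdeg, add_comm] at h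
  exact h

theorem degree_sum_C_mul_X_pow_lt (d : ℕ) (c : ℕ → ℂ) :
    (∑ i ∈ Finset.range d, Polynomial.C (c i) * X ^ i : ℂ[X]).degree < d := by
  rw [← mem_degreeLT]
  refine Submodule.sum_mem _ fun i hi => mem_degreeLT.2 ?_
  exact lt_of_le_of_lt (degree_C_mul_X_pow_le _ _)
    (by exact_mod_cast Finset.mem_range.1 hi)

/-- The monic polynomial with given lower coefficients. -/
def monicOf (d : ℕ) (c : ℕ → ℂ) : ℂ[X] :=
  X ^ d + ∑ i ∈ Finset.range d, Polynomial.C (c i) * X ^ i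

theorem monicOf_monic (d : ℕ) (c : ℕ → ℂ) : (monicOf d c).Monic :=
  monic_X_pow_add (degree_sum_C_mul_X_pow_lt d c)

theorem natDegree_monicOf (d : ℕ) (c : ℕ → ℂ) : (monicOf d c).natDegree = d := by
  have h := degree_sum_C_mul_X_pow_lt d c
  rw [monicOf, natDegree_eq_of_degree_eq_some]
  rw [degree_add_eq_left_of_degree_lt (by rwa [degree_X_pow]), degree_X_pow]

theorem eval_monicOf (d : ℕ) (c : ℕ → ℂ) (a : ℂ) :
    (monicOf d c).eval a = a ^ d + ∑ i ∈ Finset.range d, c i * a ^ i := by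
  simp [monicOf, eval_finsetSum]

theorem coeff_monicOf {d : ℕ} (c : ℕ → ℂ) {i : ℕ} (hi : i < d) : (monicOf d c).coeff i = c i := by
  simp [monicOf, coeff_X_pow, hi.ne, hi]

/-- The difference has degree below d and vanishes at d points. -/
theorem monicOf_eq_of_roots {d : ℕ} {c c' : ℕ → ℂ} {s : Finset ℂ} (hs : s.card = d)
    (h : ∀ a ∈ s, (monicOf d c).eval a = 0) (h' : ∀ a ∈ s, (monicOf d c').eval a = 0) :
    monicOf d c = monicOf d c' := by
  refine eq_of_degree_sub_lt_of_eval_finset_eq s ?_ fun a ha => by rw [h a ha, h' a ha]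
  rw [hs, monicOf, monicOf, add_sub_add_left_eq_sub]
  exact (degree_sub_le _ _).trans_lt
    (max_lt (degree_sum_C_mul_X_pow_lt d c) (degree_sum_C_mul_X_pow_lt d c'))

theorem card_le_of_roots_monicOf {d : ℕ} {c : ℕ → ℂ} {s : Finset ℂ}
    (h : ∀ a ∈ s, (monicOf d c).eval a = 0) : s.card ≤ d := by
  have := Polynomial.card_le_degree_of_subset_roots (p := monicOf d c) (Z := s) ?_
  · rwa [natDegree_monicOf] at this
  · intro a ha
    rw [mem_roots (monicOf_monic d c).ne_zero]
    exact h a ha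

end RatDecomp

end

/-! ### Hamiltonian functions and complementary right factors -/

noncomputable section

namespace RatDecomp

open Filter Topology Polynomial IntermediateField

/-- The monodromy group of `F` contains a transitive Hamiltonian subgroup, for some choice of a
non-critical value. -/
def IsHamiltonianFunction (F : RatFunc ℂ) : Prop :=
  ∃ w, IsNoncriticalValue F w ∧ HasHamiltonianAction F w

theorem IsHamiltonianFunction.at {F : RatFunc ℂ} (hF : degree F ≠ 0)
    (h : IsHamiltonianFunction F) {w : OnePoint ℂ} (hw : IsNoncriticalValue F w) :
    HasHamiltonianAction F w := by
  obtain ⟨a, ha, h⟩ := h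
  exact h.of_base hF ha hw

theorem IsHamiltonianFunction.left {A B : RatFunc ℂ} (hA : degree A ≠ 0) (hB : degree B ≠ 0)
    (h : IsHamiltonianFunction (comp A B)) : IsHamiltonianFunction A := by
  obtain ⟨w, hw, h⟩ := h
  exact ⟨w, (hw.of_comp hA hB).1, h.left hA hB⟩

theorem IsHamiltonianFunction.right {A B : RatFunc ℂ} (hA : degree A ≠ 0) (hB : degree B ≠ 0)
    (h : IsHamiltonianFunction (comp A B)) : IsHamiltonianFunction B := by
  obtain ⟨w, hw, h⟩ := h
  obtain ⟨y, hy⟩ := surjective_sphereMap hA w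
  exact ⟨y, (hw.of_comp hA hB).2 y hy, h.right hA hB hy⟩

theorem sphereMap_right_mem {F A' A : RatFunc ℂ} (hF : F = comp A' A) (hA : degree A ≠ 0)
    (x : OnePoint ℂ) : sphereMap F x = sphereMap A' (sphereMap A x) := by
  rw [hF, sphereMap_comp A' hA]

/-- Let `F = A' ∘ A = C' ∘ C` be a Hamiltonian function. If `A` and `C` generate the field of
rational functions and every function of both `A` and `C` is a function of `F`, then `A` maps the
fibers of `C` bijectively onto the fibers of `A'`, over a general point. -/
theorem exists_bijOn {F A' A C' C : RatFunc ℂ} (hFA : F = comp A' A) (hFC : F = comp C' C)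
    (hF : degree F ≠ 0) (hHam : IsHamiltonianFunction F) (hgen : adjoin ℂ {A, C} = ⊤)
    (hint : ∀ f, f ∈ ℂ⟮A⟯ → f ∈ ℂ⟮C⟯ → f ∈ ℂ⟮F⟯) :
    ∃ w, IsNoncriticalValue F w ∧
      ∀ y ∈ fiber C' w, Set.BijOn (sphereMap A) (fiber C y) (fiber A' w) := by
  classical
  obtain ⟨hA', hA⟩ := degree_ne_zero_of_comp (hFA ▸ hF)
  obtain ⟨hC', hC⟩ := degree_ne_zero_of_comp (hFC ▸ hF)
  have hFA' := sphereMap_right_mem hFA hA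
  have hFC' := sphereMap_right_mem hFC hC
  obtain ⟨b, hb, hrel⟩ := exists_monic_relation hC hgen
  set d := degree C with hd
  -- The minimal polynomial of A over ℂ(C), with coefficients evaluated at z.
  let q : ℂ → ℂ[X] := fun z => monicOf d fun i => val (b i) z
  -- properties of the points over a general value
  have hroot : ∀ᶠ z in cofinite, (q z).eval (val A z) = 0 := by
    have hterm : ∀ᶠ z in cofinite, ∀ i ∈ Finset.range d,
        val (b i * A ^ i) z = val (b i) z * val A z ^ i := by
      rw [Filter.eventually_all_finset]
      intro i _
      filter_upwards [eventually_val_mul (b i) (A ^ i), eventually_val_pow A i] with z h1 h2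
      rw [h1, h2]
    filter_upwards [hterm, eventually_val_add (A ^ d) (∑ i ∈ Finset.range d, b i * A ^ i),
      eventually_val_sum (Finset.range d) fun i => b i * A ^ i, eventually_val_pow A d]
      with z h1 h2 h3 h4
    rw [hrel, h3, h4, Finset.sum_congr rfl h1] at h2
    rw [eval_monicOf, ← h2]
    simp [val]
  have hqC : ∀ᶠ w in cofinite, ∀ x y : ℂ, sphereMap F x = w → sphereMap F y = w →
      sphereMap C x = sphereMap C y → q x = q y := by
    have : ∀ᶠ w in cofinite, ∀ i ∈ Finset.range d, ∀ x y : ℂ, sphereMap F x = w →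
        sphereMap F y = w → sphereMap C x = sphereMap C y → val (b i) x = val (b i) y := by
      rw [Filter.eventually_all_finset]
      intro i _
      refine AgreesOn.of_mem_adjoin (F := F) (R := fun x y : ℂ => sphereMap C x = sphereMap C y)
        (S := {C}) ?_ (hb i)
      rintro g rfl
      exact agreesOn_of_sphereMap_eq fun x y _ h => h
    filter_upwards [this] with w hw x y hx hy hxy
    simp only [q, monicOf]
    congr 1
    exact Finset.sum_congr rfl fun i hi => by rw [hw i hi x y hx hy hxy]
  -- The coordinate z lies in ℂ(A, C), so a point of a general fibre of F is determined by its
  -- images under A and C.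
  have hinj : ∀ᶠ w in cofinite, ∀ x y : ℂ, sphereMap F x = w → sphereMap F y = w →
      (sphereMap A x = sphereMap A y ∧ sphereMap C x = sphereMap C y) → x = y := by
    have h : AgreesOn F (fun x y => sphereMap A x = sphereMap A y ∧ sphereMap C x = sphereMap C y)
        RatFunc.X := by
      refine AgreesOn.of_mem_adjoin (S := {A, C}) ?_ (hgen ▸ mem_top)
      rintro g (rfl | rfl)
      · exact agreesOn_of_sphereMap_eq fun x y _ h => h.1
      · exact agreesOn_of_sphereMap_eq fun x y _ h => h.2
    simpa only [AgreesOn, val_X] using h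
  have hgood : ∀ᶠ w in cofinite, IsNoncriticalValue F w ∧
      (∀ p ∈ fiber F w, ∃ z : ℂ, (z : OnePoint ℂ) = p) ∧
      (∀ x : ℂ, sphereMap F x = w → (q x).eval (val A x) = 0) ∧
      (∀ x : ℂ, sphereMap F x = w → sphereMap A x = (val A x : OnePoint ℂ)) :=
    (eventually_isNoncriticalValue hF).and ((eventually_coe_of_mem_fiber F).and
      ((eventually_forall_sphereMap F hroot).and
        (eventually_forall_sphereMap F (eventually_sphereMap_eq_val A))))
  -- the values of `A` on the part of the fiber of `F` where `C` is constant
  have hroots : ∀ᶠ w in cofinite, ∀ z : ℂ, sphereMap F z = w → ∃ s : Finset ℂ, s.card = d ∧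
      (∀ a ∈ s, (q z).eval a = 0) ∧
      ∀ a : ℂ, a ∈ s ↔ ∃ x : ℂ, sphereMap C x = sphereMap C z ∧ sphereMap A x = a := by
    filter_upwards [hgood, hqC, hinj] with w ⟨hw, hcoe, hr, hA0⟩ hqC hinj z hz
    have hCF : ∀ x, sphereMap C x = sphereMap C z → sphereMap F x = w := fun x hx => by
      rw [hFC', hx, ← hFC', hz]
    have hnc : IsNoncriticalValue C (sphereMap C z) :=
      ((hFC ▸ hw).of_comp hC' hC).2 _ ((hFC' z).symm.trans hz)
    have hfin := finite_fiber hC (sphereMap C z)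
    let T : Set ℂ := {x : ℂ | sphereMap C x = sphereMap C z}
    have hT : ((↑) '' T : Set (OnePoint ℂ)) = fiber C (sphereMap C z) := by
      ext p
      constructor
      · rintro ⟨x, hx, rfl⟩
        exact hx
      · intro hp
        obtain ⟨x, rfl⟩ := hcoe p (hCF p hp)
        exact ⟨x, hp, rfl⟩
    have hTfin : T.Finite := by
      rw [← hT] at hfin
      exact hfin.of_finite_image OnePoint.coe_injective.injOn
    have hTcard : T.ncard = d := by
      rw [← Set.ncard_image_of_injective T OnePoint.coe_injective, hT]
      exact (isNoncriticalValue_iff hC _).1 hnc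
    refine ⟨hTfin.toFinset.image (val A), ?_, ?_, fun a => ?_⟩
    · rw [Finset.card_image_of_injOn, ← Set.ncard_eq_toFinset_card T hTfin, hTcard]
      intro x hx y hy hxy
      simp only [Set.Finite.coe_toFinset] at hx hy
      refine hinj x y (hCF x hx) (hCF y hy) ⟨?_, Eq.trans hx (Eq.symm hy)⟩
      rw [hA0 x (hCF x hx), hA0 y (hCF y hy), hxy]
    · intro a ha
      obtain ⟨x, hx, rfl⟩ := Finset.mem_image.1 ha
      have hx' : sphereMap C x = sphereMap C z := by simpa [T] using hx
      rw [← hqC x z (hCF x hx') hz hx']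
      exact hr x (hCF x hx')
    · simp only [Finset.mem_image, Set.Finite.mem_toFinset, T, Set.mem_ofPred_eq]
      refine exists_congr fun x => and_congr_right fun hx => ?_
      rw [hA0 x (hCF x hx), OnePoint.coe_eq_coe]
  -- since the two partitions permute, the coefficients are functions of `A`, hence of `F`
  have hqA : ∀ᶠ w in cofinite, ∀ x y : ℂ, sphereMap F x = w → sphereMap F y = w →
      sphereMap A x = sphereMap A y → q x = q y := by
    filter_upwards [hgood, hroots] with w ⟨hw, hcoe, hr, hA0⟩ hroots x y hx hy hxy
    obtain ⟨s, hs, hsx, hmem⟩ := hroots x hx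
    obtain ⟨s', hs', hsy, hmem'⟩ := hroots y hy
    -- A value of A at v with C v = C y is also attained at some u with C u = C x, because the
    -- partitions permute. Then `q x` and `q y` share the d roots in s'.
    have hsub : s' ⊆ s := by
      intro a ha
      obtain ⟨v, hv, hva⟩ := (hmem' a).1 ha
      obtain ⟨u, huF, huC, huA⟩ := (hHam.at hF hw).exists_permute hFA hFC hA' hA hC' hC
        (x := x) (y := y) (z := v) hx hxy hv.symm
      obtain ⟨u, rfl⟩ := hcoe u huF
      exact (hmem a).2 ⟨u, huC.symm, huA.trans hva⟩
    refine monicOf_eq_of_roots hs' (fun a ha => hsx a (hsub ha)) hsy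
  have hbA : ∀ i ∈ Finset.range d, b i ∈ ℂ⟮F⟯ := by
    intro i hi
    refine hint _ (mem_adjoin_of_agreesOn hA ?_) (hb i)
    -- A statement about general values of F = A' ∘ A becomes one about general values of A.
    have h := (tendsto_sphereMap hA').eventually hqA
    filter_upwards [h] with u hu x y hx hy _
    have hxy := hu x y (by rw [hFA', hx]) (by rw [hFA', hy]) (hx.trans hy.symm)
    have := congrArg (fun p => coeff p i) hxy
    simpa only [q, coeff_monicOf _ (Finset.mem_range.1 hi)] using this
  have hqF : ∀ᶠ w in cofinite, ∀ x y : ℂ, sphereMap F x = w → sphereMap F y = w → q x = q y := by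
    have : ∀ᶠ w in cofinite, ∀ i ∈ Finset.range d, ∀ x y : ℂ, sphereMap F x = w →
        sphereMap F y = w → True → val (b i) x = val (b i) y := by
      rw [Filter.eventually_all_finset]
      intro i hi
      refine AgreesOn.of_mem_adjoin (F := F) (R := fun _ _ => True) (S := {F}) ?_ (hbA i hi)
      rintro g rfl
      exact agreesOn_of_sphereMap_eq fun x y h _ => h
    filter_upwards [this] with w hw x y hx hy
    simp only [q, monicOf]
    congr 1
    exact Finset.sum_congr rfl fun i hi => by rw [hw i hi x y hx hy trivial]
  obtain ⟨w, ⟨⟨hw, hcoe, hr, hA0⟩, hinj⟩, hqF⟩ := ((hgood.and hinj).and hqF).exists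
  refine ⟨w, hw, fun y hy => ?_⟩
  have hCF : ∀ x ∈ fiber C y, sphereMap F x = w := fun x hx => by
    rw [hFC', mem_fiber.1 hx]
    exact hy
  have hmaps : Set.MapsTo (sphereMap A) (fiber C y) (fiber A' w) := fun x hx => by
    rw [mem_fiber, ← hFA']
    exact hCF x hx
  have hinjOn : Set.InjOn (sphereMap A) (fiber C y) := by
    intro x hx x' hx' hxx'
    obtain ⟨x, rfl⟩ := hcoe x (hCF x hx)
    obtain ⟨x', rfl⟩ := hcoe x' (hCF x' hx')
    rw [hinj x x' (hCF x hx) (hCF x' hx') ⟨hxx', Eq.trans hx (Eq.symm hx')⟩]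
  refine ⟨hmaps, hinjOn, ?_⟩
  -- all values of `A` on the fiber of `F` are roots of one polynomial
  have hA'fin := finite_fiber hA' w
  have hA'le : (fiber A' w).ncard ≤ d := by
    obtain ⟨z, hz⟩ := surjective_sphereMap hF w
    obtain ⟨z, rfl⟩ := hcoe z hz
    have hsubset : ∀ u ∈ fiber A' w, ∃ a : ℂ, (a : OnePoint ℂ) = u ∧ (q z).eval a = 0 := by
      intro u hu
      obtain ⟨x, rfl⟩ := surjective_sphereMap hA u
      have hx : sphereMap F x = w := (hFA' x).trans hu
      obtain ⟨x, rfl⟩ := hcoe x hx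
      refine ⟨val A x, (hA0 x hx).symm, ?_⟩
      rw [hqF z x hz hx]
      exact hr x hx
    choose! a ha ha' using hsubset
    rw [Set.ncard_eq_toFinset_card _ hA'fin, ← Finset.card_image_of_injOn (f := a)]
    · refine card_le_of_roots_monicOf (c := fun i => val (b i) z) fun c hc => ?_
      obtain ⟨u, hu, rfl⟩ := Finset.mem_image.1 hc
      exact ha' u (by simpa using hu)
    · intro u hu u' hu' h
      simp only [Set.Finite.coe_toFinset] at hu hu'
      rw [← ha u hu, ← ha u' hu', h]
  have hncard : (fiber C y).ncard = d :=
    (isNoncriticalValue_iff hC y).1 (((hFC ▸ hw).of_comp hC' hC).2 y hy)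
  have himg : sphereMap A '' fiber C y = fiber A' w := by
    refine Set.eq_of_subset_of_ncard_le hmaps.image_subset ?_ hA'fin
    rw [hinjOn.ncard_image, hncard]
    exact hA'le
  exact himg.ge

end RatDecomp

end

noncomputable section

namespace RatDecomp

open Filter Topology Polynomial IntermediateField

/-! ### Pairs of decompositions of length two -/

/-- The bijection between a fibre of C and one of A' gives equal degrees;
`HasHamiltonianAction.exists_move` supplies the corrections needed in `sameMonodromy_of_bijOn`. -/
theorem bijOn_consequences {F A' A C' C : RatFunc ℂ} (hFA : F = comp A' A) (hFC : F = comp C' C)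
    (hF : degree F ≠ 0) (hHam : IsHamiltonianFunction F) (hgen : adjoin ℂ {A, C} = ⊤)
    (hint : ∀ f, f ∈ ℂ⟮A⟯ → f ∈ ℂ⟮C⟯ → f ∈ ℂ⟮F⟯) :
    degree C = degree A' ∧ SameMonodromy C A' := by
  obtain ⟨hA', hA⟩ := degree_ne_zero_of_comp (hFA ▸ hF)
  obtain ⟨hC', hC⟩ := degree_ne_zero_of_comp (hFC ▸ hF)
  obtain ⟨w, hw, hbij⟩ := exists_bijOn hFA hFC hF hHam hgen hint
  obtain ⟨y, hy⟩ := surjective_sphereMap hC' w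
  have hb := hbij y hy
  constructor
  · rw [← (isNoncriticalValue_iff hC y).1 (((hFC ▸ hw).of_comp hC' hC).2 y hy),
      ← (isNoncriticalValue_iff hA' w).1 ((hFA ▸ hw).of_comp hA' hA).1, ← hb.image_eq,
      hb.injOn.ncard_image]
  · subst hFA
    exact sameMonodromy_of_bijOn hA' hA hC' hC hFC hw hy hb
      ((hHam.at hF hw).exists_move rfl hA' hA)

/-- If the left factor `A'` of `F = A' ∘ A = C' ∘ C` is indecomposable and `A` is not a function
of `C`, then every function of both `A` and `C` is a function of `F`. -/
theorem mem_adjoin_of_isIndecomposable {F A' A C' C : RatFunc ℂ} (hFA : F = comp A' A)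
    (hFC : F = comp C' C) (hF : degree F ≠ 0) (hind : IsIndecomposable A') (hAC : A ∉ ℂ⟮C⟯)
    (f : RatFunc ℂ) (hfA : f ∈ ℂ⟮A⟯) (hfC : f ∈ ℂ⟮C⟯) : f ∈ ℂ⟮F⟯ := by
  obtain ⟨hA', hA⟩ := degree_ne_zero_of_comp (hFA ▸ hF)
  obtain ⟨hC', hC⟩ := degree_ne_zero_of_comp (hFC ▸ hF)
  have hmem : F ∈ ℂ⟮A⟯ ⊓ ℂ⟮C⟯ := mem_inf.2 ⟨(mem_adjoin_iff hA).2 ⟨A', hFA⟩,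
    (mem_adjoin_iff hC).2 ⟨C', hFC⟩⟩
  -- Writing ℂ(A) ∩ ℂ(C) = ℂ(h) yields A' = β ∘ α with F = β ∘ h and h = α ∘ A. Either deg β = 1 and
  -- ℂ(h) = ℂ(F), or deg α = 1 and ℂ(h) = ℂ(A), which would put A in ℂ(C).
  obtain ⟨h, hh, hE⟩ := exists_eq_adjoin hmem hF
  have hself : h ∈ ℂ⟮A⟯ ⊓ ℂ⟮C⟯ := hE ▸ mem_adjoin_simple_self ℂ h
  obtain ⟨α, hα⟩ := (mem_adjoin_iff hA).1 (mem_inf.1 hself).1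
  obtain ⟨β, hβ⟩ := (mem_adjoin_iff hh).1 (hE ▸ hmem)
  have hA'eq : A' = comp β α := by
    apply comp_right_cancel hA
    rw [comp_assoc _ _ hA, ← hα, ← hβ, hFA]
  rcases hind β α hA'eq with h1 | h1
  · rw [hβ, adjoin_eq_of_comp h1 hh, ← hE]
    exact mem_inf.2 ⟨hfA, hfC⟩
  · exfalso
    apply hAC
    have : A ∈ ℂ⟮A⟯ ⊓ ℂ⟮C⟯ := by
      rw [hE, hα, adjoin_eq_of_comp h1 hA]
      exact mem_adjoin_simple_self ℂ A
    exact (mem_inf.1 this).2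

/-- Let a = α ∘ β. If c is in ℂ(β), then ℂ(β) contains a and c, so deg β = 1. Otherwise
indecomposability of C' makes β and c a complementary pair as well, so deg c = deg A' · deg α, and
comparison with deg c = deg A' gives deg α = 1. -/
theorem isIndecomposable_of_pair {H A' a C' c : RatFunc ℂ} (hHa : H = comp A' a)
    (hHc : H = comp C' c) (hH : degree H ≠ 0) (hHam : IsHamiltonianFunction H)
    (hgen : adjoin ℂ {a, c} = ⊤) (hind : IsIndecomposable C') (hdeg : degree c = degree A') :
    IsIndecomposable a := by
  obtain ⟨hA', ha⟩ := degree_ne_zero_of_comp (hHa ▸ hH)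
  obtain ⟨hC', hc⟩ := degree_ne_zero_of_comp (hHc ▸ hH)
  intro α β hab
  obtain ⟨hα, hβ⟩ := degree_ne_zero_of_comp (hab ▸ ha)
  have haβ : a ∈ ℂ⟮β⟯ := (mem_adjoin_iff hβ).2 ⟨α, hab⟩
  by_cases hcβ : c ∈ ℂ⟮β⟯
  · right
    have htop : ℂ⟮β⟯ = ⊤ := by
      rw [eq_top_iff, ← hgen, adjoin_le_iff]
      rintro f (rfl | rfl)
      · exact haβ
      · exact hcβ
    rw [← finrank_adjoin]
    exact IntermediateField.finrank_eq_one_iff_eq_top.2 htop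
  · left
    have hHβ : H = comp (comp A' α) β := by rw [comp_assoc _ _ hβ, ← hab, hHa]
    have hgen' : adjoin ℂ {β, c} = ⊤ := by
      rw [eq_top_iff, ← hgen, adjoin_le_iff]
      rintro f (rfl | rfl)
      · exact adjoin.mono ℂ {β} {β, c} (by simp) haβ
      · exact subset_adjoin _ _ (by simp)
    have h := (bijOn_consequences hHβ hHc hH hHam hgen' fun f hf1 hf2 =>
      mem_adjoin_of_isIndecomposable hHc hHβ hH hind hcβ f hf2 hf1).1
    rw [hdeg, degree_comp hA' hα] at h
    exact Nat.eq_of_mul_eq_mul_left (Nat.pos_of_ne_zero hA') (by rw [← h, mul_one])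

/-! ### Lists of rational functions -/

theorem degree_foldr_comp {L : List (RatFunc ℂ)} (h : ∀ A ∈ L, 1 < degree A) :
    degree (L.foldr comp RatFunc.X) ≠ 0 ∧ (degree (L.foldr comp RatFunc.X) = 1 → L = []) := by
  induction L with
  | nil => simp [degree_X]
  | cons A L ih =>
    have hA : 1 < degree A := h A (by simp)
    obtain ⟨h1, -⟩ := ih fun B hB => h B (by simp [hB])
    have h2 := degree_comp (A := A) (B := L.foldr comp RatFunc.X) (by omega) h1
    rw [List.foldr_cons, h2]
    refine ⟨mul_ne_zero (by omega) h1, fun h3 => ?_⟩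
    have := Nat.eq_one_of_mul_eq_one_right h3
    omega

theorem IsMaximalDecomposition.degree_ne_zero {F : RatFunc ℂ} {L : List (RatFunc ℂ)}
    (h : IsMaximalDecomposition F L) : degree F ≠ 0 := by
  rw [h.1]
  exact (degree_foldr_comp fun A hA => (h.2 A hA).2).1

theorem IsMaximalDecomposition.eq_nil {F : RatFunc ℂ} {L : List (RatFunc ℂ)}
    (h : IsMaximalDecomposition F L) (hF : degree F = 1) : L = [] := by
  have := (degree_foldr_comp fun A hA => (h.2 A hA).2).2
  rw [← h.1] at this
  exact this hF

theorem IsMaximalDecomposition.cons {F A G : RatFunc ℂ} {L : List (RatFunc ℂ)}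
    (hF : F = comp A G) (hA : IsIndecomposable A) (hA1 : 1 < degree A)
    (h : IsMaximalDecomposition G L) : IsMaximalDecomposition F (A :: L) := by
  refine ⟨?_, fun B hB => ?_⟩
  · rw [IsDecomposition, List.foldr_cons, ← h.1, hF]
  · rcases List.mem_cons.1 hB with rfl | hB
    · exact ⟨hA, hA1⟩
    · exact h.2 B hB

theorem IsMaximalDecomposition.of_cons {F A : RatFunc ℂ} {L : List (RatFunc ℂ)}
    (h : IsMaximalDecomposition F (A :: L)) :
    IsIndecomposable A ∧ 1 < degree A ∧ ∃ G, F = comp A G ∧ IsMaximalDecomposition G L :=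
  ⟨(h.2 A (by simp)).1, (h.2 A (by simp)).2, L.foldr comp RatFunc.X, h.1, rfl,
    fun B hB => h.2 B (by simp [hB])⟩

theorem isMaximalDecomposition_nil : IsMaximalDecomposition RatFunc.X [] :=
  ⟨rfl, by simp⟩

theorem IsMaximalDecomposition.append {F G H : RatFunc ℂ} {L M : List (RatFunc ℂ)}
    (hL : IsMaximalDecomposition F L) (hM : IsMaximalDecomposition G M) (hH : H = comp F G) :
    IsMaximalDecomposition H (L ++ M) := by
  induction L generalizing F H with
  | nil =>
    have : F = RatFunc.X := hL.1
    rw [this, X_comp] at hH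
    rwa [hH]
  | cons A L ih =>
    obtain ⟨h1, h2, F', hF', hL'⟩ := hL.of_cons
    refine IsMaximalDecomposition.cons (G := comp F' G) ?_ h1 h2 (ih hL' rfl)
    rw [hH, hF', comp_assoc _ _ hM.degree_ne_zero]

theorem exists_isMaximalDecomposition {F : RatFunc ℂ} (hF : 1 < degree F) :
    ∃ L, IsMaximalDecomposition F L := by
  induction hn : degree F using Nat.strong_induction_on generalizing F with
  | _ n ih =>
    by_cases hind : IsIndecomposable F
    · refine ⟨[F], IsMaximalDecomposition.cons (comp_X F).symm hind hF isMaximalDecomposition_nil⟩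
    · simp only [IsIndecomposable, not_forall, not_or] at hind
      obtain ⟨A, B, hAB, hA1, hB1⟩ := hind
      obtain ⟨hA0, hB0⟩ := degree_ne_zero_of_comp (A := A) (B := B) (by rw [← hAB]; omega)
      have hdeg := degree_comp hA0 hB0
      rw [← hAB, hn] at hdeg
      have hA2 : 1 < degree A := by omega
      have hB2 : 1 < degree B := by omega
      obtain ⟨L, hL⟩ := ih (degree A) (by rw [hdeg]; nlinarith) hA2 rfl
      obtain ⟨M, hM⟩ := ih (degree B) (by rw [hdeg]; nlinarith) hB2 rfl
      exact ⟨L ++ M, hL.append hM hAB⟩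

theorem IsIndecomposable.degree_one_comp {A μ : RatFunc ℂ} (hA : IsIndecomposable A)
    (hμ : degree μ = 1) : IsIndecomposable (comp μ A) := by
  intro P Q hPQ
  -- A constant is a composition of two constants, so it is not indecomposable in the present sense.
  by_cases hA0 : degree A = 0
  · exfalso
    obtain ⟨c, rfl⟩ := degree_eq_zero_iff.1 hA0
    rcases hA (RatFunc.C c) (RatFunc.C c) (by rw [C_comp]) with h | h <;> simp [degree_C] at h
  obtain ⟨ν, hν, hνμ, -⟩ := exists_inverse_of_degree_one hμ
  obtain ⟨hP, hQ⟩ := degree_ne_zero_of_comp (A := P) (B := Q) (by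
    rw [← hPQ]
    exact degree_comp_ne_zero (by omega) hA0)
  have : A = comp (comp ν P) Q := by
    rw [comp_assoc _ _ hQ, ← hPQ, ← comp_assoc _ _ hA0, hνμ, X_comp]
  have hd := hA _ _ this
  rwa [degree_comp (by omega) hP, hν, one_mul] at hd

/-! ### The Jordan–Hölder argument -/

/-- A move between maximal decompositions of `F`. -/
def MaximalMove (F : RatFunc ℂ) (L L' : List (RatFunc ℂ)) : Prop :=
  IsMaximalDecomposition F L ∧ IsMaximalDecomposition F L' ∧ RittMove L L'

theorem reflTransGen_cons {F A G : RatFunc ℂ} (hF : F = comp A G) (hA : IsIndecomposable A)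
    (hA1 : 1 < degree A) {L L' : List (RatFunc ℂ)}
    (h : Relation.ReflTransGen (MaximalMove G) L L') :
    Relation.ReflTransGen (MaximalMove F) (A :: L) (A :: L') := by
  refine h.lift (fun L => A :: L) ?_
  rintro M M' ⟨h1, h2, l, r, P, Q, P', Q', h3, rfl, rfl⟩
  exact ⟨h1.cons hF hA hA1, h2.cons hF hA hA1, A :: l, r, P, Q, P', Q', h3, rfl, rfl⟩

/-- Nonconstant rational functions with permutation equivalent monodromy groups. -/
def MonodromyRel (A B : RatFunc ℂ) : Prop := degree A ≠ 0 ∧ degree B ≠ 0 ∧ SameMonodromy A B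

instance : IsTrans (RatFunc ℂ) MonodromyRel :=
  ⟨fun _ _ _ h h' => ⟨h.1, h'.2.1, h.2.2.trans h.2.1 h'.2.2⟩⟩

theorem rel_refl_of_isMaximalDecomposition {F : RatFunc ℂ} {L : List (RatFunc ℂ)}
    (h : IsMaximalDecomposition F L) :
    Multiset.Rel MonodromyRel (L : Multiset (RatFunc ℂ)) L := by
  refine Multiset.rel_refl_of_refl_on fun A hA => ?_
  have hA1 := (h.2 A (by simpa using hA)).2
  exact ⟨by omega, by omega, sameMonodromy_refl (by omega)⟩

/-- A Lüroth generator of ℂ(A, C) is the bottom of the diamond. If it has degree one, it is replaced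
by the identity, whose maximal decomposition is empty. -/
theorem exists_common_right_factor {A C : RatFunc ℂ} (hA : degree A ≠ 0) :
    ∃ p Q, IsMaximalDecomposition p Q ∧ adjoin ℂ {A, C} = ℂ⟮p⟯ := by
  have hAmem : A ∈ adjoin ℂ {A, C} := subset_adjoin _ _ (by simp)
  obtain ⟨p, hp, hE⟩ := exists_eq_adjoin hAmem hA
  by_cases hp1 : degree p = 1
  · refine ⟨RatFunc.X, [], isMaximalDecomposition_nil, ?_⟩
    have := adjoin_eq_of_comp hp1 (B := RatFunc.X) (by simp [degree_X])
    rw [comp_X] at this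
    rw [hE, this]
  · obtain ⟨Q, hQ⟩ := exists_isMaximalDecomposition (F := p) (by omega)
    exact ⟨p, Q, hQ, hE⟩

/-- Precomposition with p is injective and carries ℂ(a, c) onto ℂ(p), so the preimage z of p lies in
ℂ(a, c). -/
theorem adjoin_pair_eq_top {a c p : RatFunc ℂ} (hp : degree p ≠ 0)
    (h : adjoin ℂ {comp a p, comp c p} = ℂ⟮p⟯) : adjoin ℂ {a, c} = ⊤ := by
  have hmap : (adjoin ℂ {a, c}).map (compHom hp) = ℂ⟮p⟯ := by
    rw [adjoin_map, Set.image_pair, compHom_apply, compHom_apply, h]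
  have hpmem : p ∈ (adjoin ℂ {a, c}).map (compHom hp) := hmap ▸ mem_adjoin_simple_self ℂ p
  obtain ⟨u, hu, hup⟩ := hpmem
  have huX : u = RatFunc.X := by
    have huX' : compHom hp u = compHom hp RatFunc.X := by
      rw [compHom_apply hp RatFunc.X, X_comp]
      exact hup
    exact (compHom hp).toRingHom.injective huX'
  subst huX
  rw [eq_top_iff, ← RatFunc.adjoin_X, adjoin_simple_le_iff]
  exact hu

/-- Induction on deg F, comparing the left factors of F = A' ∘ A = C' ∘ C. Moves between
decompositions of A or C become moves for F when the left factor is put back. -/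
theorem jordanHolder {F : RatFunc ℂ} (hHam : IsHamiltonianFunction F) {U V : List (RatFunc ℂ)}
    (hU : IsMaximalDecomposition F U) (hV : IsMaximalDecomposition F V) :
    Relation.ReflTransGen (MaximalMove F) U V ∧
      Multiset.Rel MonodromyRel (U : Multiset (RatFunc ℂ)) V := by
  induction hn : degree F using Nat.strong_induction_on generalizing F U V with
  | _ n ih =>
  have hF := hU.degree_ne_zero
  rcases U with _ | ⟨A', U'⟩
  · have : F = RatFunc.X := hU.1
    have hVnil := hV.eq_nil (by rw [this, degree_X])
    subst hVnil
    exact ⟨.refl, rel_refl_of_isMaximalDecomposition hU⟩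
  rcases V with _ | ⟨C', V'⟩
  · have : F = RatFunc.X := hV.1
    have hUnil := hU.eq_nil (by rw [this, degree_X])
    simp at hUnil
  obtain ⟨hA'i, hA'1, A, hFA, hAU⟩ := hU.of_cons
  obtain ⟨hC'i, hC'1, C, hFC, hCV⟩ := hV.of_cons
  have hA' : degree A' ≠ 0 := by omega
  have hC' : degree C' ≠ 0 := by omega
  have hA := hAU.degree_ne_zero
  have hC := hCV.degree_ne_zero
  have hHamA : IsHamiltonianFunction A := (hFA ▸ hHam).right hA' hA
  have hHamC : IsHamiltonianFunction C := (hFC ▸ hHam).right hC' hC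
  have hltA : degree A < n := by
    rw [← hn, hFA, degree_comp hA' hA]
    have := Nat.pos_of_ne_zero hA
    nlinarith
  have hltC : degree C < n := by
    rw [← hn, hFC, degree_comp hC' hC]
    have := Nat.pos_of_ne_zero hC
    nlinarith
  by_cases hAC : A ∈ ℂ⟮C⟯
  -- The left factors differ by a degree-one μ. One move replaces A', μ ∘ B by C', B, and induction
  -- on A treats the rest; if V has length one, U and V are equal.
  · obtain ⟨μ, hμA⟩ := (mem_adjoin_iff hC).1 hAC
    have hC'eq : C' = comp A' μ := by
      apply comp_right_cancel hC
      rw [comp_assoc _ _ hC, ← hμA, ← hFA, ← hFC]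
    have hμ : degree μ = 1 := (hC'i A' μ hC'eq).resolve_left (by omega)
    rcases V' with _ | ⟨B, V''⟩
    · have hCX : C = RatFunc.X := hCV.1
      rw [hCX, comp_X] at hμA
      have hU'nil := hAU.eq_nil (by rw [hμA, hμ])
      subst hU'nil
      have hAX : A = RatFunc.X := hAU.1
      rw [hAX, comp_X] at hFA
      rw [hCX, comp_X] at hFC
      rw [← hFA, ← hFC] at *
      exact ⟨.refl, rel_refl_of_isMaximalDecomposition hU⟩
    · obtain ⟨hBi, hB1, G, hCG, hGV⟩ := hCV.of_cons
      have hB : degree B ≠ 0 := by omega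
      have hG := hGV.degree_ne_zero
      have hμB1 : 1 < degree (comp μ B) := by rw [degree_comp (by omega) hB, hμ, one_mul]; exact hB1
      have hAV : IsMaximalDecomposition A (comp μ B :: V'') := by
        refine hGV.cons ?_ (hBi.degree_one_comp hμ) hμB1
        rw [comp_assoc _ _ hG, ← hCG, hμA]
      obtain ⟨h1, h2⟩ := ih _ hltA hHamA hAU hAV rfl
      constructor
      · refine (reflTransGen_cons hFA hA'i hA'1 h1).tail
          ⟨hAV.cons hFA hA'i hA'1, hV, [], V'', A', comp μ B, C', B, ?_, rfl, rfl⟩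
        rw [hC'eq, comp_assoc _ _ hB]
      · rw [← Multiset.cons_coe, ← Multiset.cons_coe]
        refine Multiset.Rel.cons ⟨hA', hC', ?_⟩ (h2.trans _ ?_)
        · rw [hC'eq]
          exact (sameMonodromy_comp_degree_one hA' hμ).symm
        · rw [← Multiset.cons_coe, ← Multiset.cons_coe]
          exact Multiset.Rel.cons ⟨by omega, hB, (sameMonodromy_degree_one_comp hB hμ).symm⟩
            (rel_refl_of_isMaximalDecomposition hGV)
  -- The diamond: U is connected to A', a, Q by induction on A, then one move leads to C', c, Q, and
  -- induction on C leads to V.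
  · obtain ⟨p, Q, hpQ, hE⟩ := exists_common_right_factor (C := C) hA
    have hp := hpQ.degree_ne_zero
    obtain ⟨a, ha⟩ := (mem_adjoin_iff hp).1 (hE ▸ subset_adjoin ℂ {A, C} (by simp) : A ∈ ℂ⟮p⟯)
    obtain ⟨c, hc⟩ := (mem_adjoin_iff hp).1 (hE ▸ subset_adjoin ℂ {A, C} (by simp) : C ∈ ℂ⟮p⟯)
    have ha0 : degree a ≠ 0 := (degree_ne_zero_of_comp (ha ▸ hA)).1
    have hc0 : degree c ≠ 0 := (degree_ne_zero_of_comp (hc ▸ hC)).1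
    have hac : comp A' a = comp C' c := by
      apply comp_right_cancel hp
      rw [comp_assoc _ _ hp, comp_assoc _ _ hp, ← ha, ← hc, ← hFA, ← hFC]
    have hH : degree (comp A' a) ≠ 0 := degree_comp_ne_zero hA' ha0
    have hHamH : IsHamiltonianFunction (comp A' a) := by
      refine IsHamiltonianFunction.left (B := p) hH hp ?_
      rwa [comp_assoc _ _ hp, ← ha, ← hFA]
    have hgen : adjoin ℂ {a, c} = ⊤ := adjoin_pair_eq_top hp (by rw [← ha, ← hc, hE])
    have hgen' : adjoin ℂ {c, a} = ⊤ := by rw [Set.pair_comm, hgen]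
    have hacn : a ∉ ℂ⟮c⟯ := by
      intro h
      obtain ⟨u, hu⟩ := (mem_adjoin_iff hc0).1 h
      apply hAC
      refine (mem_adjoin_iff hC).2 ⟨u, ?_⟩
      rw [ha, hu, comp_assoc _ _ hp, ← hc]
    have hint := mem_adjoin_of_isIndecomposable rfl hac hH hA'i hacn
    obtain ⟨hdc, hmc⟩ := bijOn_consequences rfl hac hH hHamH hgen hint
    obtain ⟨hda, hma⟩ := bijOn_consequences hac rfl hH hHamH hgen' fun f h1 h2 => hint f h2 h1
    have hai : IsIndecomposable a := isIndecomposable_of_pair rfl hac hH hHamH hgen hC'i hdc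
    have hci : IsIndecomposable c := isIndecomposable_of_pair hac rfl hH hHamH hgen' hA'i hda
    have haQ : IsMaximalDecomposition A (a :: Q) := hpQ.cons ha hai (by omega)
    have hcQ : IsMaximalDecomposition C (c :: Q) := hpQ.cons hc hci (by omega)
    obtain ⟨h1, h2⟩ := ih _ hltA hHamA hAU haQ rfl
    obtain ⟨h3, h4⟩ := ih _ hltC hHamC hcQ hCV rfl
    constructor
    · refine ((reflTransGen_cons hFA hA'i hA'1 h1).tail ?_).trans
        (reflTransGen_cons hFC hC'i hC'1 h3)
      exact ⟨haQ.cons hFA hA'i hA'1, hcQ.cons hFC hC'i hC'1, [], Q, A', a, C', c, hac, rfl, rfl⟩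
    · have hr1 : Multiset.Rel MonodromyRel ((A' :: U' : List _) : Multiset (RatFunc ℂ))
          (A' :: a :: Q : List _) := by
        rw [← Multiset.cons_coe, ← Multiset.cons_coe]
        exact Multiset.Rel.cons ⟨hA', hA', sameMonodromy_refl hA'⟩ h2
      have hr2 : Multiset.Rel MonodromyRel ((A' :: a :: Q : List _) : Multiset (RatFunc ℂ))
          (C' :: c :: Q : List _) := by
        simp only [← Multiset.cons_coe]
        -- The move crosses the factors: A' is matched with c, and a with C'.
        rw [Multiset.cons_swap C' c]
        exact Multiset.Rel.cons ⟨hA', hc0, hmc.symm⟩ (Multiset.Rel.cons ⟨ha0, hC', hma⟩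
          (rel_refl_of_isMaximalDecomposition hpQ))
      have hr3 : Multiset.Rel MonodromyRel ((C' :: c :: Q : List _) : Multiset (RatFunc ℂ))
          (C' :: V' : List _) := by
        rw [← Multiset.cons_coe, ← Multiset.cons_coe]
        exact Multiset.Rel.cons ⟨hC', hC', sameMonodromy_refl hC'⟩ h4
      exact (hr1.trans _ hr2).trans _ hr3

/-! ### Conclusion -/

theorem exists_forall₂_perm_of_rel {α β : Type*} {r : α → β → Prop} {U : List α} {V : List β}
    (h : Multiset.Rel r (U : Multiset α) V) : ∃ W, List.Forall₂ r U W ∧ W.Perm V := by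
  induction U generalizing V with
  | nil =>
    rw [Multiset.coe_nil, Multiset.rel_zero_left, Multiset.coe_eq_zero] at h
    exact ⟨[], .nil, by rw [h]⟩
  | cons a U ih =>
    rw [← Multiset.cons_coe, Multiset.rel_cons_left] at h
    obtain ⟨b, t, hab, ht, hV⟩ := h
    induction t using Quotient.inductionOn with
    | _ B =>
      obtain ⟨W, hW, hWB⟩ := ih ht
      refine ⟨b :: W, .cons hab hW, (hWB.cons b).trans ?_⟩
      exact (Multiset.coe_eq_coe.1 hV).symm

theorem exists_equiv_of_rel {α : Type*} {r : α → α → Prop} {U V : List α}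
    (h : Multiset.Rel r (U : Multiset α) V) :
    ∃ e : Fin U.length ≃ Fin V.length, ∀ i, r (U.get i) (V.get (e i)) := by
  classical
  obtain ⟨W, hW, hWV⟩ := exists_forall₂_perm_of_rel h
  have hlen : U.length = W.length := hW.length_eq
  refine ⟨(finCongr hlen).trans ⟨hWV.idxBij, hWV.symm.idxBij,
    hWV.idxBij_rightInverse_idxBij_symm, hWV.idxBij_leftInverse_idxBij_symm⟩, fun i => ?_⟩
  have hget := (List.forall₂_iff_get.1 hW).2 i i.2 (hlen ▸ i.2)
  have hV := hWV.getElem_idxBij_eq_getElem (finCongr hlen i)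
  simp only [List.get_eq_getElem, Equiv.trans_apply, Equiv.coe_fn_mk] at hget ⊢
  rw [hV]
  exact hget

theorem decompEquiv_refl (U : List (RatFunc ℂ)) : DecompEquiv U U :=
  ⟨rfl, fun _ => RatFunc.X, fun _ => degree_X, rfl, rfl, fun i hi => by rw [comp_X, X_comp]⟩

end RatDecomp

end

theorem corollary2p11 (F : RatFunc ℂ) (w : OnePoint ℂ)
    (hw : RatDecomp.IsNoncriticalValue F w)
    (K : Subgroup (Equiv.Perm (RatDecomp.fiber F w)))
    (hKG : K ≤ RatDecomp.monodromyGroup F w hw)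
    (hKtrans : MulAction.IsPretransitive K (RatDecomp.fiber F w))
    (hKham : RatDecomp.IsHamiltonian K)
    (U V : List (RatFunc ℂ))
    (hU : RatDecomp.IsMaximalDecomposition F U)
    (hV : RatDecomp.IsMaximalDecomposition F V) :
    RatDecomp.WeaklyEquivalent F U V ∧
      U.length = V.length ∧
      ∃ σ : Fin U.length ≃ Fin V.length, ∀ i : Fin U.length,
        RatDecomp.SameMonodromy (U.get i) (V.get (σ i)) := by
  have hHam : RatDecomp.IsHamiltonianFunction F :=
    ⟨w, hw, K, inferInstance, K.subtype, fun g => hKG g.2,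
      fun x y => hKtrans.exists_smul_eq x y, hKham⟩
  obtain ⟨h1, h2⟩ := RatDecomp.jordanHolder hHam hU hV
  obtain ⟨σ, hσ⟩ := RatDecomp.exists_equiv_of_rel h2
  -- The chain ends at V itself, since degree-one changes were absorbed into the moves.
  exact ⟨⟨V, h1, RatDecomp.decompEquiv_refl V⟩, by simpa using Fintype.card_congr σ, σ,
    fun i => (hσ i).2.2⟩
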